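/- Let $\mathcal N=\{1,\dots,N\}$ be the nodes of a directed graph, $\delta(n)$ the set of nodes $\nu$ with an edge $(\nu,n)$, and let $\mathcal N$ be partitioned into groups $\mathcal N_1,\dots,\mathcal N_C$. Fix $I,K\in\mathbb N$, $W\in\mathbb R$, $A\in\mathbb R^{R\times N}$, $b\in\mathbb R^R$, and put $\mathcal K=\{1,\dots,K\}$, $$\mathcal X=\Big\{x\in\{0,1\}^N:\sum_n x_n\le I\Big\},\qquad \mathcal Y=\Big\{y\in\{0,1\}^N:\sum_{n\in\mathcal N_c}y_n\ge W|\mathcal N_c|\ \ \forall c\Big\},$$ $$\mathcal T=\{\xi\in\mathbb R^N:A\xi\ge b\},\qquad \Xi=\{0,1\}^N\cap\mathcal T .$$ Assume that $\mathcal T$ is upward closed in $[0,1]^N$: if $\xi\in\mathcal T\cap[0,1]^N$, $\xi'\in[0,1]^N$ and $\xi'\ge\xi$, then $\xi'\in\mathcal T$. The $K$-adaptability counterpart of the fair robust covering problem is $$(\mathrm P)\qquad \max_{x\in\mathcal X,\ y^1,\dots,y^K\in\mathcal Y}\ \Phi(x,y),\qquad \Phi(x,y)=\min_{\xi\in\Xi}\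 \max_{k\in\mathcal K}\Big\{\sum_{n}y^k_n\ :\ y^k_n\le\sum_{\nu\in\delta(n)}\xi_\nu x_\nu\ \ \forall n\in\mathcal N\Big\},$$ where an empty maximum is $-\infty$ and an empty minimum is $+\infty$. Let $\mathcal L=\{0,\dots,N\}^K$, let $\mathcal L_+$ be the set of $\ell\in\mathcal L$ with all components positive, $\mathcal L_0=\mathcal L\setminus\mathcal L_+$, and $\Delta_K(\ell)=\{\lambda\in\mathbb R^K_+:\sum_k\lambda_k=1,\ \lambda_k=0\text{ whenever }\ell_k\ne0\}$. Consider the mixed-integer bilinear program $(\mathrm B)$ that maximizes $\tau\in\mathbb R$ over $\tau$, $x\in\mathcal X$, $y^1,\dots,y^K\in\mathcal Y$ and the following further variables. For every $\ell\in\mathcal L_0$: $\theta(\ell),\beta^k(\ell)\in\mathbb R^N_+$ $(k\in\mathcal K)$, $\alpha(\ell)\in\mathbb R^R_+$, $\nu(\ell)\in\mathbb R^K_+$, $\lambda(\ell)\in\Delta_K(\ell)$ with $$\tau\le-\sum_n\theta_n(\ell)+b^\top\alpha(\ell)-\sum_{k:\ell_k\ne0}(y^k_{\ell_k}-1)\nu_k(\ell)+\sum_{k:\ell_k=0}\sum_n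 y^k_n\beta^k_n(\ell)+\sum_k\lambda_k(\ell)\sum_n y^k_n,$$ $$\theta_n(\ell)\ \ge\ (A^\top\alpha(\ell))_n-\sum_{k:\,\ell_k\ne0,\ n\in\delta(\ell_k)}x_n\,\nu_k(\ell)+\sum_{k:\,\ell_k=0}\ \sum_{m:\,n\in\delta(m)}x_n\,\beta^k_m(\ell)\qquad\forall n\in\mathcal N .$$ For every $\ell\in\mathcal L_+$: $\theta(\ell)\in\mathbb R^N_+$, $\alpha(\ell)\in\mathbb R^R_+$, $\nu(\ell)\in\mathbb R^K_+$ with $$1\le-\sum_n\theta_n(\ell)+b^\top\alpha(\ell)-\sum_{k}(y^k_{\ell_k}-1)\nu_k(\ell),\qquad \theta_n(\ell)\ \ge\ (A^\top\alpha(\ell))_n-\sum_{k:\,n\in\delta(\ell_k)}x_n\,\nu_k(\ell)\quad\forall n\in\mathcal N .$$ Then: (i) $(\mathrm P)$ and $(\mathrm B)$ are equivalent: for all $\tau,x,y$, the point $(\tau,x,y)$ extends to a feasible point of $(\mathrm B)$ if and only if $x\in\mathcal X$, all $y^k\in\mathcal Y$ and $\tau\le\Phi(x,y)$. The two problems have the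 same optimal value in $[-\infty,\infty]$, and for real $\tau$, $(\tau,x,y)$ extends to an optimal solution of $(\mathrm B)$ if and only if $(x,y)$ is an optimal solution of $(\mathrm P)$ with value $\tau$. (ii) All bilinear terms of $(\mathrm B)$ are products $uv$ of a binary variable $u$ and a continuous variable $v\ge0$. Let $(\mathrm B_M)$ be the MILP obtained from $(\mathrm B)$ by replacing every such product by a new variable $w$ subject to $0\le w\le Mu$ and $v-M(1-u)\le w\le v$ (auxiliary variables are also allowed for products $x_n\nu_k(\ell)$, $x_n\beta^k_m(\ell)$, $y^k_n\nu_k(\ell)$, $y^k_n\beta^k_n(\ell)$ whose coefficient is zero). There is $M_0$ such that for all $M\ge M_0$, $(\mathrm B_M)$ is equivalent to $(\mathrm B)$: every feasible point of $(\mathrm B_M)$ restricts to a feasible point of $(\mathrm B)$ and satisfies $w=uv$ for every product; for every feasible point of $(\mathrm B)$ there is a feasible point of $(\mathrm B_M)$ with the same $(\tau,x,y)$; and the optimal values are equal. (iii) $|\mathcal L|=(N+1)^K$, and the size (number of variables plus number of constraints) of $(\mathrm B_M)$ scales with $|\mathcal L|$: the number of constraints is at least $|\mathcal L|$, and the size is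 at most $p(N,C,R,K)\,(N+1)^K$ for a fixed polynomial $p$. For every fixed $K$ it is bounded by a polynomial in $N,C,R$. -/

import Mathlib

open scoped Matrix

noncomputable section

namespace FairCover

/-- Upward closedness in the unit cube `[0,1]^N`, with the componentwise order: membership of a
point of the cube is inherited by every larger point of the cube. -/
def IsUpwardClosed {N : ℕ} (S : Set (Fin N → ℝ)) : Prop :=
  ∀ ξ ∈ S, ξ ∈ Set.Icc (0 : Fin N → ℝ) 1 →
    ∀ ξ' ∈ Set.Icc (0 : Fin N → ℝ) 1, ξ ≤ ξ' → ξ' ∈ S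

/-- `0`-`1` vectors. -/
def IsBinary {ι : Type} (v : ι → ℝ) : Prop := ∀ i, v i = 0 ∨ v i = 1

/-- The data of the fair robust covering problem: a directed graph on `N` nodes
(`graph.Adj ν n` means that `ν` can cover `n`), a partition of the nodes into `C` groups, the number
`budget` of monitors, the fraction `W` of each group that has to be covered, and the system
`A ξ ≥ b` of `R` inequalities that describes the uncertainty set. -/
structure Data (N C R : ℕ) where
  graph : Digraph (Fin N)
  group : Fin N → Fin C
  budget : ℕ
  W : ℝ
  A : Matrix (Fin R) (Fin N) ℝ
  b : Fin R → ℝ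

/-- The index set `{0,…,N}^K`; `none` stands for the index `0`, and `some n` for the node `n`. -/
abbrev Idx (N K : ℕ) : Type := Fin K → Option (Fin N)

/-- The indices `ℓ` with at least one zero component. -/
abbrev Idx0 (N K : ℕ) : Type := {ℓ : Idx N K // ∃ k, ℓ k = none}

/-- The indices `ℓ > 0`, that is, with no zero component. -/
abbrev IdxPos (N K : ℕ) : Type := {ℓ : Idx N K // ∀ k, ℓ k ≠ none}

/-- The continuous variables of the bilinear program other than `τ`. -/
structure Duals (N R K : ℕ) where
  θ : Idx N K → Fin N → ℝ
  α : Idx N K → Fin R → ℝ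
  ν : Idx N K → Fin K → ℝ
  β : Idx0 N K → Fin K → Fin N → ℝ
  lam : Idx0 N K → Fin K → ℝ

/-- The simplex `Δ_K(ℓ)`: weights on the indices `k` with `ℓ k = 0`. -/
def simplex {N K : ℕ} (ℓ : Idx N K) : Set (Fin K → ℝ) :=
  {lam | 0 ≤ lam ∧ ∑ k, lam k = 1 ∧ ∀ k, ℓ k ≠ none → lam k = 0}

namespace Data

variable {N C R K : ℕ} (D : Data N C R)

open Classical in
/-- The set `δ(n)` of the nodes that can cover `n`. -/
def nbr (n : Fin N) : Finset (Fin N) := {ν | D.graph.Adj ν n}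

/-- The `c`-th group of nodes. -/
def groupSet (c : Fin C) : Finset (Fin N) := {n | D.group n = c}

/-- The feasible monitor choices. -/
def X : Set (Fin N → ℝ) := {x | IsBinary x ∧ ∑ n, x n ≤ D.budget}

/-- The covering schemes that meet the fairness constraints. -/
def Y : Set (Fin N → ℝ) :=
  {y | IsBinary y ∧ ∀ c, D.W * (D.groupSet c).card ≤ ∑ n ∈ D.groupSet c, y n}

/-- The polyhedron `T = {ξ : A ξ ≥ b}`. -/
def T : Set (Fin N → ℝ) := {ξ | D.b ≤ D.A *ᵥ ξ}

/-- The uncertainty set `Ξ = {0,1}^N ∩ T`. -/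
def Unc : Set (Fin N → ℝ) := {ξ | IsBinary ξ ∧ ξ ∈ D.T}

/-- The covering scheme `y` is justified by the monitors `x` when the availability is `ξ`. -/
def Covers (x ξ y : Fin N → ℝ) : Prop := ∀ n, y n ≤ ∑ v ∈ D.nbr n, ξ v * x v

/-- The worst-case value of the candidates `y 1, …, y K`: the minimum over `ξ ∈ Ξ` of the maximum of
`∑ n, y k n` over the `k` for which `y k` is justified. A maximum over no candidate is `-∞`, a
minimum over an empty `Ξ` is `+∞`. -/
def worstCase (x : Fin N → ℝ) (y : Fin K → Fin N → ℝ) : EReal :=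
  ⨅ ξ ∈ D.Unc, ⨆ (k : Fin K) (_ : D.Covers x ξ (y k)), ((∑ n, y k n : ℝ) : EReal)

/-- The first-stage decisions of the `K`-adaptability problem. -/
def FirstStage (x : Fin N → ℝ) (y : Fin K → Fin N → ℝ) : Prop := x ∈ D.X ∧ ∀ k, y k ∈ D.Y

/-- The optimal value of the `K`-adaptability problem. -/
def adaptValue (K : ℕ) : EReal :=
  ⨆ (x : Fin N → ℝ) (y : Fin K → Fin N → ℝ) (_ : D.FirstStage x y), D.worstCase x y

/-- The part `-eᵀθ + αᵀb - ∑_{k : ℓ k ≠ 0} (y^k_{ℓ k} - 1) ν_k` of the right-hand sides. -/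
def dualObj (y : Fin K → Fin N → ℝ) (ℓ : Idx N K)
    (θ : Fin N → ℝ) (α : Fin R → ℝ) (ν : Fin K → ℝ) : ℝ :=
  -∑ n, θ n + ∑ r, α r * D.b r - ∑ k, ∑ m with ℓ k = some m, (y k m - 1) * ν k

/-- The constraints of the bilinear program for an index `ℓ` with a zero component. -/
def ZeroBlock (τ : ℝ) (x : Fin N → ℝ) (y : Fin K → Fin N → ℝ) (ℓ : Idx N K)
    (θ : Fin N → ℝ) (α : Fin R → ℝ) (ν : Fin K → ℝ) (β : Fin K → Fin N → ℝ)
    (lam : Fin K → ℝ) : Prop :=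
  0 ≤ θ ∧ 0 ≤ α ∧ 0 ≤ ν ∧ 0 ≤ β ∧ lam ∈ simplex ℓ ∧
  τ ≤ D.dualObj y ℓ θ α ν + ∑ k with ℓ k = none, ∑ n, y k n * β k n + ∑ k, lam k * ∑ n, y k n ∧
  ∀ n, (D.Aᵀ *ᵥ α) n - ∑ k, ∑ m with ℓ k = some m ∧ n ∈ D.nbr m, x n * ν k
    + ∑ k with ℓ k = none, ∑ m with n ∈ D.nbr m, x n * β k m ≤ θ n

/-- The constraints of the bilinear program for an index `ℓ > 0`. -/
def PosBlock (x : Fin N → ℝ) (y : Fin K → Fin N → ℝ) (ℓ : Idx N K)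
    (θ : Fin N → ℝ) (α : Fin R → ℝ) (ν : Fin K → ℝ) : Prop :=
  0 ≤ θ ∧ 0 ≤ α ∧ 0 ≤ ν ∧
  1 ≤ D.dualObj y ℓ θ α ν ∧
  ∀ n, (D.Aᵀ *ᵥ α) n - ∑ k, ∑ m with ℓ k = some m ∧ n ∈ D.nbr m, x n * ν k ≤ θ n

/-- The feasible set of the mixed-integer bilinear program, whose objective is `τ`. -/
def BilinearFeasible (τ : ℝ) (x : Fin N → ℝ) (y : Fin K → Fin N → ℝ) (d : Duals N R K) : Prop :=
  D.FirstStage x y ∧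
  (∀ ℓ : Idx0 N K, D.ZeroBlock τ x y ℓ (d.θ ℓ) (d.α ℓ) (d.ν ℓ) (d.β ℓ) (d.lam ℓ)) ∧
  (∀ ℓ : IdxPos N K, D.PosBlock x y ℓ (d.θ ℓ) (d.α ℓ) (d.ν ℓ))

/-- The optimal value of the mixed-integer bilinear program. -/
def bilinearValue (K : ℕ) : EReal :=
  ⨆ (τ : ℝ) (x : Fin N → ℝ) (y : Fin K → Fin N → ℝ) (d : Duals N R K)
    (_ : D.BilinearFeasible τ x y d), (τ : EReal)

end Data

/-- A mixed-integer linear program: maximize a linear objective subject to one inequality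
`row c z ≤ rhs c` for each `c`, where the variables in `integral` have to be integers. -/
structure MILP (V Con : Type) where
  obj : (V → ℝ) →ₗ[ℝ] ℝ
  row : Con → (V → ℝ) →ₗ[ℝ] ℝ
  rhs : Con → ℝ
  integral : Set V

namespace MILP

variable {V Con : Type} (P : MILP V Con)

def Feasible (z : V → ℝ) : Prop :=
  (∀ c, P.row c z ≤ P.rhs c) ∧ ∀ v ∈ P.integral, ∃ i : ℤ, z v = i

def value : EReal := ⨆ (z : V → ℝ) (_ : P.Feasible z), (P.obj z : EReal)

def numVars (_ : MILP V Con) : ℕ := Nat.card V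

def numCons (_ : MILP V Con) : ℕ := Nat.card Con

end MILP

/-- The variables of the bilinear program. -/
inductive BaseVar (N R K : ℕ) : Type
  | τ
  | x (n : Fin N)
  | y (k : Fin K) (n : Fin N)
  | θ (ℓ : Idx N K) (n : Fin N)
  | α (ℓ : Idx N K) (r : Fin R)
  | ν (ℓ : Idx N K) (k : Fin K)
  | β (ℓ : Idx0 N K) (k : Fin K) (n : Fin N)
  | lam (ℓ : Idx0 N K) (k : Fin K)

/-- The products of a binary and a continuous variable. -/
inductive Product (N K : ℕ) : Type
  | xν (ℓ : Idx N K) (n : Fin N) (k : Fin K)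
  | yν (ℓ : Idx N K) (k : Fin K) (n : Fin N)
  | xβ (ℓ : Idx0 N K) (n : Fin N) (k : Fin K) (m : Fin N)
  | yβ (ℓ : Idx0 N K) (k : Fin K) (n : Fin N)
  | ylam (ℓ : Idx0 N K) (k : Fin K) (n : Fin N)

/-- The binary factor of a product. -/
def Product.bin {N K : ℕ} (R : ℕ) : Product N K → BaseVar N R K
  | .xν _ n _ => .x n
  | .yν _ k n => .y k n
  | .xβ _ n _ _ => .x n
  | .yβ _ k n => .y k n
  | .ylam _ k n => .y k n

/-- The continuous factor of a product. -/
def Product.cont {N K : ℕ} (R : ℕ) : Product N K → BaseVar N R K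
  | .xν ℓ _ k => .ν ℓ k
  | .yν ℓ k _ => .ν ℓ k
  | .xβ ℓ _ k m => .β ℓ k m
  | .yβ ℓ k n => .β ℓ k n
  | .ylam ℓ k _ => .lam ℓ k

/-- The variables of the MILP: those of the bilinear program, and one for each product. -/
abbrev Var (N R K : ℕ) : Type := BaseVar N R K ⊕ Product N K

/-- The names of the inequalities of the MILP. -/
inductive Ineq (N C R K : ℕ) : Type
  | xNonneg (n : Fin N)
  | xLeOne (n : Fin N)
  | yNonneg (k : Fin K) (n : Fin N)
  | yLeOne (k : Fin K) (n : Fin N)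
  | budget
  | fair (k : Fin K) (c : Fin C)
  | θNonneg (ℓ : Idx N K) (n : Fin N)
  | αNonneg (ℓ : Idx N K) (r : Fin R)
  | νNonneg (ℓ : Idx N K) (k : Fin K)
  | βNonneg (ℓ : Idx0 N K) (k : Fin K) (n : Fin N)
  | lamNonneg (ℓ : Idx0 N K) (k : Fin K)
  | lamSumLe (ℓ : Idx0 N K)
  | lamSumGe (ℓ : Idx0 N K)
  | lamZero (ℓ : Idx0 N K) (k : Fin K)
  | epi (ℓ : Idx0 N K)
  | dualZero (ℓ : Idx0 N K) (n : Fin N)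
  | cert (ℓ : IdxPos N K)
  | dualPos (ℓ : IdxPos N K) (n : Fin N)
  | prodNonneg (p : Product N K)
  | prodLeBin (p : Product N K)
  | prodLeCont (p : Product N K)
  | prodGe (p : Product N K)

namespace Data

variable {N C R K : ℕ} (D : Data N C R)

/-- The coordinate functional of a variable of the bilinear program. -/
def base (v : BaseVar N R K) : (Var N R K → ℝ) →ₗ[ℝ] ℝ := LinearMap.proj (Sum.inl v)

/-- The coordinate functional of the variable that replaces a product. -/
def prd (p : Product N K) : (Var N R K → ℝ) →ₗ[ℝ] ℝ := LinearMap.proj (Sum.inr p)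

/-- The linearization of `-dualObj`. -/
def negDualObjRow (ℓ : Idx N K) : (Var N R K → ℝ) →ₗ[ℝ] ℝ :=
  ∑ n, base (.θ ℓ n) - ∑ r, D.b r • base (.α ℓ r)
    + ∑ k, ∑ m with ℓ k = some m, (prd (.yν ℓ k m) - base (.ν ℓ k))

/-- The left-hand sides of the inequalities of the MILP. For each product `p`, the variable
`prd p` that replaces it is tied to the factors `u` (binary) and `v` (continuous) of `p` by
`0 ≤ prd p`, `prd p ≤ M u`, `prd p ≤ v` and `v - M (1 - u) ≤ prd p`. -/
def milpRow (M : ℝ) : Ineq N C R K → (Var N R K → ℝ) →ₗ[ℝ] ℝ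
  | .xNonneg n => -base (.x n)
  | .xLeOne n => base (.x n)
  | .yNonneg k n => -base (.y k n)
  | .yLeOne k n => base (.y k n)
  | .budget => ∑ n, base (.x n)
  | .fair k c => -∑ n ∈ D.groupSet c, base (.y k n)
  | .θNonneg ℓ n => -base (.θ ℓ n)
  | .αNonneg ℓ r => -base (.α ℓ r)
  | .νNonneg ℓ k => -base (.ν ℓ k)
  | .βNonneg ℓ k n => -base (.β ℓ k n)
  | .lamNonneg ℓ k => -base (.lam ℓ k)
  | .lamSumLe ℓ => ∑ k, base (.lam ℓ k)
  | .lamSumGe ℓ => -∑ k, base (.lam ℓ k)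
  | .lamZero ℓ k => if ℓ.1 k = none then 0 else base (.lam ℓ k)
  | .epi ℓ => base .τ + D.negDualObjRow ℓ.1
      - ∑ k with ℓ.1 k = none, ∑ n, prd (.yβ ℓ k n) - ∑ k, ∑ n, prd (.ylam ℓ k n)
  | .dualZero ℓ n => ∑ r, D.A r n • base (.α ℓ.1 r)
      - ∑ k, ∑ m with ℓ.1 k = some m ∧ n ∈ D.nbr m, prd (.xν ℓ.1 n k)
      + ∑ k with ℓ.1 k = none, ∑ m with n ∈ D.nbr m, prd (.xβ ℓ n k m) - base (.θ ℓ.1 n)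
  | .cert ℓ => D.negDualObjRow ℓ.1
  | .dualPos ℓ n => ∑ r, D.A r n • base (.α ℓ.1 r)
      - ∑ k, ∑ m with ℓ.1 k = some m ∧ n ∈ D.nbr m, prd (.xν ℓ.1 n k) - base (.θ ℓ.1 n)
  | .prodNonneg p => -prd p
  | .prodLeBin p => prd p - M • base (p.bin R)
  | .prodLeCont p => prd p - base (p.cont R)
  | .prodGe p => base (p.cont R) + M • base (p.bin R) - prd p

/-- The right-hand sides of the inequalities of the MILP. -/
def milpRhs (M : ℝ) : Ineq N C R K → ℝ
  | .xLeOne _ => 1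
  | .yLeOne _ _ => 1
  | .budget => D.budget
  | .fair _ c => -(D.W * (D.groupSet c).card)
  | .lamSumLe _ => 1
  | .lamSumGe _ => -1
  | .cert _ => -1
  | .prodGe _ => M
  | _ => 0

/-- The Big-`M` reformulation of the bilinear program: every product of a binary and a continuous
variable is replaced by a variable of its own. -/
def bigM (K : ℕ) (M : ℝ) : MILP (Var N R K) (Ineq N C R K) where
  obj := base .τ
  row := D.milpRow M
  rhs := D.milpRhs M
  integral := {v | (∃ n, v = Sum.inl (.x n)) ∨ ∃ k n, v = Sum.inl (.y k n)}

end Data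

/-- The part of a point of the MILP that belongs to `x`. -/
def xPart {N R K : ℕ} (z : Var N R K → ℝ) : Fin N → ℝ := fun n => z (Sum.inl (.x n))

/-- The part of a point of the MILP that belongs to `y`. -/
def yPart {N R K : ℕ} (z : Var N R K → ℝ) : Fin K → Fin N → ℝ := fun k n => z (Sum.inl (.y k n))

/-- The part of a point of the MILP that belongs to the remaining variables of the bilinear program
other than `τ`. -/
def dualPart {N R K : ℕ} (z : Var N R K → ℝ) : Duals N R K where
  θ := fun ℓ n => z (Sum.inl (.θ ℓ n))
  α := fun ℓ r => z (Sum.inl (.α ℓ r))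
  ν := fun ℓ k => z (Sum.inl (.ν ℓ k))
  β := fun ℓ k n => z (Sum.inl (.β ℓ k n))
  lam := fun ℓ k => z (Sum.inl (.lam ℓ k))

end FairCover

end

/-! Fix binary `x` and `y`. Every scenario in `Ξ` follows a pattern `ℓ`, which records the justified
candidates (`ℓ k = none`) and, for each other candidate, a node where it fails. Hence `τ ≤ Φ(x, y)`
says that each pattern realized in `Ξ` has a justified candidate of value at least `τ`. The block of
`ℓ` in the bilinear program expresses this by linear duality. If the pattern is realized, weak
duality (`dual_le_of_pattern`) makes the dual part nonpositive, so `τ` is bounded by a `λ`-average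
of the values of justified candidates, and a positive pattern is contradictory. If it is not
realized, Farkas multipliers, scaled at will (`exists_certificate`), meet any target.

Farkas needs infeasibility on the whole cube, not only at binary points. Rounding all positive
entries up closes this gap: upward closedness keeps the point in `T`, justified candidates stay
justified, and a failing node sees only vanishing terms, which rounding preserves
(`pattern_roundUp`).

For Big-M, `M` need only bound `ν`, `β` and `λ`. For nonempty `Ξ`, `τ ≤ N`, so a target depending on
`N` alone suffices; there are finitely many triples `(x, y, ℓ)`, and one certificate for each gives
a uniform bound. For empty `Ξ`, `α` and `θ`, which occur in no product, certify everything. The size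
bounds follow from injective encodings of the variables and rows. -/

noncomputable section

namespace FairCover

/-! ### Linear alternatives on the unit cube -/

/-- Theorem of the alternative for a system of linear inequalities on the unit cube. -/
theorem exists_multipliers_of_infeasible {ι κ : Type*} [Fintype ι] [Fintype κ]
    (G : ι → κ → ℝ) (h : ι → ℝ)
    (hinf : ¬ ∃ ξ ∈ Set.Icc (0 : κ → ℝ) 1, ∀ i, h i ≤ ∑ n, G i n * ξ n) :
    ∃ (u : ι → ℝ) (θ : κ → ℝ), 0 ≤ u ∧ 0 ≤ θ ∧ (∀ n, ∑ i, u i * G i n ≤ θ n) ∧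
      0 < -∑ n, θ n + ∑ i, u i * h i := by
  classical
  let F : (κ → ℝ) →ₗ[ℝ] (ι → ℝ) := Matrix.toLin' (Matrix.of G)
  have hF : ∀ ξ i, F ξ i = ∑ n, G i n * ξ n := by
    intro ξ i
    simp [F, Matrix.mulVec, dotProduct]
  have hcont : Continuous F := LinearMap.continuous_of_finiteDimensional F
  -- Infeasibility means that the image of the cube, compact and convex, misses the closed orthant
  -- above `h`, so the two can be strictly separated.
  have hdisj : Disjoint (F '' Set.Icc 0 1) (Set.Ici h) := by
    rw [Set.disjoint_left]
    rintro _ ⟨ξ, hξ, rfl⟩ hh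
    exact hinf ⟨ξ, hξ, fun i => (hF ξ i) ▸ hh i⟩
  obtain ⟨f, u, v, hu, huv, hv⟩ := geometric_hahn_banach_compact_closed
    ((convex_Icc (0 : κ → ℝ) 1).linear_image F) (isCompact_Icc.image hcont)
    (convex_Ici h) isClosed_Ici hdisj
  let c : ι → ℝ := fun i => f (Pi.single i 1)
  have hf : ∀ z, f z = ∑ i, c i * z i := by
    intro z
    conv_lhs => rw [← Finset.univ_sum_single z]
    rw [map_sum]
    refine Finset.sum_congr rfl fun i _ => ?_
    have : (Pi.single i (z i) : ι → ℝ) = z i • Pi.single i (1 : ℝ) := by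
      rw [← Pi.single_smul]; simp
    rw [this, map_smul, smul_eq_mul, mul_comm]
  have hc : 0 ≤ c := by
    intro i
    by_contra hneg
    have hneg : c i < 0 := not_le.mp hneg
    have hh := hv h Set.self_mem_Ici
    have hr : 0 ≤ (f h - v) / (-c i) := div_nonneg (by linarith) (by linarith)
    -- A negative coefficient lets `f` decrease along the orthant; this step length brings it
    -- exactly to `v`, against the strict bound.
    have := hv (h + ((f h - v) / (-c i)) • Pi.single i (1 : ℝ)) (by
      rw [Set.mem_Ici, le_add_iff_nonneg_right]
      exact smul_nonneg hr (Pi.single_nonneg.2 zero_le_one))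
    rw [map_add, map_smul, smul_eq_mul] at this
    change v < f h + (f h - v) / (-c i) * c i at this
    have e : (f h - v) / (-c i) * c i = -(f h - v) := by
      rw [div_neg, neg_mul, div_mul_cancel₀ _ hneg.ne]
    rw [e] at this
    linarith
  refine ⟨c, fun n => max 0 (∑ i, c i * G i n), hc, fun n => le_max_left _ _,
    fun n => le_max_right _ _, ?_⟩
  -- The vertex of the cube that maximizes `f ∘ F`; its value is the sum of the positive parts
  -- chosen as `θ`.
  let ξ : κ → ℝ := fun n => if 0 < ∑ i, c i * G i n then 1 else 0
  have hξ : ξ ∈ Set.Icc (0 : κ → ℝ) 1 := by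
    constructor <;> intro n <;> by_cases hn : 0 < ∑ i, c i * G i n <;> simp [ξ, hn]
  have h1 := hu _ (Set.mem_image_of_mem F hξ)
  have h2 := hv h Set.self_mem_Ici
  have e : f (F ξ) = ∑ n, max 0 (∑ i, c i * G i n) := by
    rw [hf]
    simp_rw [hF, Finset.mul_sum]
    rw [Finset.sum_comm]
    refine Finset.sum_congr rfl fun n _ => ?_
    simp_rw [← mul_assoc]
    rw [← Finset.sum_mul]
    by_cases hn : 0 < ∑ i, c i * G i n
    · simp [ξ, hn, hn.le]
    · simp [ξ, hn, not_lt.mp hn]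
  rw [← hf h]
  linarith

/-- The multipliers of an infeasible system can be scaled to certify any given bound. -/
theorem exists_multipliers_of_infeasible_ge {ι κ : Type*} [Fintype ι] [Fintype κ]
    (G : ι → κ → ℝ) (h : ι → ℝ)
    (hinf : ¬ ∃ ξ ∈ Set.Icc (0 : κ → ℝ) 1, ∀ i, h i ≤ ∑ n, G i n * ξ n) (t : ℝ) :
    ∃ (u : ι → ℝ) (θ : κ → ℝ), 0 ≤ u ∧ 0 ≤ θ ∧ (∀ n, ∑ i, u i * G i n ≤ θ n) ∧
      t ≤ -∑ n, θ n + ∑ i, u i * h i := by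
  obtain ⟨u, θ, hu, hθ, hG, hpos⟩ := exists_multipliers_of_infeasible G h hinf
  set e := -∑ n, θ n + ∑ i, u i * h i with he
  have hs : 0 ≤ |t| / e := div_nonneg (abs_nonneg t) hpos.le
  refine ⟨(|t| / e) • u, (|t| / e) • θ, smul_nonneg hs hu, smul_nonneg hs hθ, fun n => ?_, ?_⟩
  · simp only [Pi.smul_apply, smul_eq_mul, mul_assoc, ← Finset.mul_sum]
    exact mul_le_mul_of_nonneg_left (hG n) hs
  · simp only [Pi.smul_apply, smul_eq_mul, mul_assoc, ← Finset.mul_sum]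
    have : -(|t| / e * ∑ n, θ n) + |t| / e * ∑ i, u i * h i = |t| := by
      rw [← mul_neg, ← mul_add, ← he]
      field_simp
    rw [this]
    exact le_abs_self t

/-! ### Binary vectors, rounding and patterns -/

theorem IsBinary.nonneg {ι : Type} {v : ι → ℝ} (h : IsBinary v) (i : ι) : 0 ≤ v i := by
  rcases h i with h | h <;> simp [h]

theorem IsBinary.le_one {ι : Type} {v : ι → ℝ} (h : IsBinary v) (i : ι) : v i ≤ 1 := by
  rcases h i with h | h <;> simp [h]

theorem exists_bool_of_isBinary {ι : Type} {v : ι → ℝ} (h : IsBinary v) :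
    ∃ p : ι → Bool, v = fun i => if p i then 1 else 0 := by
  classical
  refine ⟨fun i => decide (v i = 1), funext fun i => ?_⟩
  rcases h i with h | h <;> simp [h]

/-- Rounding every positive entry up to one. -/
def roundUp {ι : Type} (ξ : ι → ℝ) : ι → ℝ := fun i => if ξ i = 0 then 0 else 1

theorem isBinary_roundUp {ι : Type} (ξ : ι → ℝ) : IsBinary (roundUp ξ) := by
  intro i
  by_cases h : ξ i = 0 <;> simp [roundUp, h]

theorem le_roundUp {ι : Type} {ξ : ι → ℝ} (h : ξ ≤ 1) : ξ ≤ roundUp ξ := by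
  intro i
  by_cases hi : ξ i = 0
  · simp [roundUp, hi]
  · simpa [roundUp, hi] using h i

namespace Data

variable {N C R K : ℕ} (D : Data N C R)

/-- All uses of upward closedness pass through this passage from fractional to binary scenarios. -/
theorem roundUp_mem_Unc (hT : IsUpwardClosed D.T) {ξ : Fin N → ℝ} (h : ξ ∈ D.T)
    (hξ : ξ ∈ Set.Icc (0 : Fin N → ℝ) 1) : roundUp ξ ∈ D.Unc :=
  ⟨isBinary_roundUp ξ, hT ξ h hξ _
    ⟨fun i => (isBinary_roundUp ξ).nonneg i, fun i => (isBinary_roundUp ξ).le_one i⟩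
    (le_roundUp hξ.2)⟩

/-- The availability `ξ` follows the pattern `ℓ`: the candidates with `ℓ k = 0` are justified, and
each other candidate fails at the node `ℓ k`. -/
def Pattern (x : Fin N → ℝ) (y : Fin K → Fin N → ℝ) (ℓ : Idx N K) (ξ : Fin N → ℝ) : Prop :=
  (∀ k m, ℓ k = some m → ∑ n ∈ D.nbr m, ξ n * x n ≤ y k m - 1) ∧
  ∀ k, ℓ k = none → D.Covers x ξ (y k)

/-- At a failing node a sum of nonnegative terms is at most `y k m - 1 ≤ 0`, so every term has a
zero factor and survives rounding. Coverage is monotone in `ξ`. -/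
theorem pattern_roundUp {x : Fin N → ℝ} {y : Fin K → Fin N → ℝ} {ℓ : Idx N K} {ξ : Fin N → ℝ}
    (hx : IsBinary x) (hy : ∀ k, IsBinary (y k)) (hξ : ξ ∈ Set.Icc (0 : Fin N → ℝ) 1)
    (h : D.Pattern x y ℓ ξ) : D.Pattern x y ℓ (roundUp ξ) := by
  refine ⟨fun k m hk => ?_, fun k hk n => (h.2 k hk n).trans ?_⟩
  · have h1 := h.1 k m hk
    have hnn : ∀ n ∈ D.nbr m, 0 ≤ ξ n * x n := fun n _ => mul_nonneg (hξ.1 n) (hx.nonneg n)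
    have h2 := Finset.sum_nonneg hnn
    have h3 := (hy k).le_one m
    have h4 := (Finset.sum_eq_zero_iff_of_nonneg hnn).1 (by linarith)
    have : ∑ n ∈ D.nbr m, roundUp ξ n * x n = 0 := by
      refine Finset.sum_eq_zero fun n hn => ?_
      rcases mul_eq_zero.1 (h4 n hn) with h | h <;> simp [roundUp, h]
    linarith
  · exact Finset.sum_le_sum fun n _ =>
      mul_le_mul_of_nonneg_right (le_roundUp hξ.2 n) (hx.nonneg n)

/-- For binary data a violated cover constraint has `y k m = 1` and an integer sum below one, hence
zero. This is why strict failure can be written as the closed inequality with `y k m - 1`. -/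
theorem exists_pattern {x : Fin N → ℝ} {y : Fin K → Fin N → ℝ} {ξ : Fin N → ℝ}
    (hx : IsBinary x) (hy : ∀ k, IsBinary (y k)) (hξ : IsBinary ξ) :
    ∃ ℓ : Idx N K, D.Pattern x y ℓ ξ := by
  classical
  have key : ∀ k, ∃ o : Option (Fin N),
      (∀ m, o = some m → ∑ n ∈ D.nbr m, ξ n * x n ≤ y k m - 1) ∧
      (o = none → D.Covers x ξ (y k)) := by
    intro k
    by_cases hc : D.Covers x ξ (y k)
    · exact ⟨none, by simp, fun _ => hc⟩
    · simp only [Covers, not_forall, not_le] at hc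
      obtain ⟨m, hm⟩ := hc
      refine ⟨some m, ?_, by simp⟩
      rintro _ ⟨⟩
      have hy1 : y k m = 1 := by
        rcases hy k m with h | h
        · exact absurd (Finset.sum_nonneg fun n (_ : n ∈ D.nbr m) =>
            mul_nonneg (hξ.nonneg n) (hx.nonneg n)) (by linarith)
        · exact h
      rw [hy1, sub_self]
      refine (Finset.sum_eq_zero fun n hn => ?_).le
      by_contra hne
      have h1 : ξ n * x n = 1 := by
        rcases hξ n with h | h <;> rcases hx n with h' | h' <;> simp [h, h'] at hne ⊢
      have := Finset.single_le_sum (f := fun n => ξ n * x n)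
        (fun n _ => mul_nonneg (hξ.nonneg n) (hx.nonneg n)) hn
      simp only [h1] at this
      linarith
  choose ℓ hℓ using key
  exact ⟨ℓ, fun k m h => (hℓ k).1 m h, fun k h => (hℓ k).2 h⟩

/-- A scenario may follow several patterns, since failing nodes can be chosen differently, but all
of them have the same zero components. -/
theorem covers_iff_of_pattern {x : Fin N → ℝ} {y : Fin K → Fin N → ℝ} {ℓ : Idx N K}
    {ξ : Fin N → ℝ} (h : D.Pattern x y ℓ ξ) (k : Fin K) : D.Covers x ξ (y k) ↔ ℓ k = none := by
  refine ⟨fun hc => ?_, h.2 k⟩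
  cases hk : ℓ k with
  | none => rfl
  | some m => linarith [h.1 k m hk, hc m]

/-! ### Duality for a fixed pattern -/

/-- Weak duality. -/
theorem dual_le_of_pattern {x : Fin N → ℝ} {y : Fin K → Fin N → ℝ} {ℓ : Idx N K} {ξ : Fin N → ℝ}
    (hξ : ξ ∈ D.Unc) (h : D.Pattern x y ℓ ξ) {θ : Fin N → ℝ} {α : Fin R → ℝ} {ν : Fin K → ℝ}
    {β : Fin K → Fin N → ℝ} (hθ : 0 ≤ θ) (hα : 0 ≤ α) (hν : 0 ≤ ν) (hβ : 0 ≤ β)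
    (hd : ∀ n, (D.Aᵀ *ᵥ α) n - ∑ k, ∑ m with ℓ k = some m ∧ n ∈ D.nbr m, x n * ν k
      + ∑ k with ℓ k = none, ∑ m with n ∈ D.nbr m, x n * β k m ≤ θ n) :
    D.dualObj y ℓ θ α ν + ∑ k with ℓ k = none, ∑ n, y k n * β k n ≤ 0 := by
  -- Weight dual row `n` by `ξ n`; here `0 ≤ ξ n ≤ 1` and `0 ≤ θ n` give `θ n * ξ n ≤ θ n`. The
  -- three bounds below then insert the primal rows.
  have h1 : ∑ n, ((D.Aᵀ *ᵥ α) n - ∑ k, ∑ m with ℓ k = some m ∧ n ∈ D.nbr m, x n * ν k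
      + ∑ k with ℓ k = none, ∑ m with n ∈ D.nbr m, x n * β k m) * ξ n ≤ ∑ n, θ n := by
    refine Finset.sum_le_sum fun n _ => (mul_le_mul_of_nonneg_right (hd n) (hξ.1.nonneg n)).trans ?_
    exact mul_le_of_le_one_right (hθ n) (hξ.1.le_one n)
  simp only [add_mul, sub_mul, Finset.sum_add_distrib, Finset.sum_sub_distrib] at h1
  have hA : ∑ r, α r * D.b r ≤ ∑ n, (D.Aᵀ *ᵥ α) n * ξ n := by
    have : ∑ n, (D.Aᵀ *ᵥ α) n * ξ n = ∑ r, α r * (D.A *ᵥ ξ) r := by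
      change (D.Aᵀ *ᵥ α) ⬝ᵥ ξ = α ⬝ᵥ (D.A *ᵥ ξ)
      rw [Matrix.mulVec_transpose, Matrix.dotProduct_mulVec]
    rw [this]
    exact Finset.sum_le_sum fun r _ => mul_le_mul_of_nonneg_left (hξ.2 r) (hα r)
  have hN : ∑ n, (∑ k, ∑ m with ℓ k = some m ∧ n ∈ D.nbr m, x n * ν k) * ξ n
      ≤ ∑ k, ∑ m with ℓ k = some m, (y k m - 1) * ν k := by
    simp only [Finset.sum_mul]
    rw [Finset.sum_comm]
    refine Finset.sum_le_sum fun k _ => ?_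
    simp only [Finset.sum_filter, ite_and]
    rw [Finset.sum_comm]
    refine Finset.sum_le_sum fun m _ => ?_
    by_cases hk : ℓ k = some m
    · simp only [hk, if_true]
      rw [← Finset.sum_filter, Finset.filter_mem_eq_inter, Finset.univ_inter]
      refine le_trans (le_of_eq ?_) (mul_le_mul_of_nonneg_right (h.1 k m hk) (hν k))
      rw [Finset.sum_mul]
      exact Finset.sum_congr rfl fun n _ => by ring
    · simp [hk]
  have hB : ∑ k with ℓ k = none, ∑ n, y k n * β k n
      ≤ ∑ n, (∑ k with ℓ k = none, ∑ m with n ∈ D.nbr m, x n * β k m) * ξ n := by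
    simp only [Finset.sum_mul]
    refine le_of_le_of_eq ?_ Finset.sum_comm
    refine Finset.sum_le_sum fun k hk => ?_
    simp only [Finset.sum_filter]
    rw [Finset.sum_comm]
    refine Finset.sum_le_sum fun m _ => ?_
    rw [← Finset.sum_filter, Finset.filter_mem_eq_inter, Finset.univ_inter]
    refine (mul_le_mul_of_nonneg_right (h.2 k (Finset.mem_filter.1 hk).2 m) (hβ k m)).trans
      (le_of_eq ?_)
    rw [Finset.sum_mul]
    exact Finset.sum_congr rfl fun n _ => by ring
  unfold dualObj
  linarith

/-- Strong duality for an infeasible pattern: every bound has a dual certificate. -/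
theorem exists_certificate (hT : IsUpwardClosed D.T) {x : Fin N → ℝ} {y : Fin K → Fin N → ℝ}
    (hx : IsBinary x) (hy : ∀ k, IsBinary (y k)) {ℓ : Idx N K}
    (hℓ : ∀ ξ ∈ D.Unc, ¬ D.Pattern x y ℓ ξ) (t : ℝ) :
    ∃ (θ : Fin N → ℝ) (α : Fin R → ℝ) (ν : Fin K → ℝ) (β : Fin K → Fin N → ℝ),
      0 ≤ θ ∧ 0 ≤ α ∧ 0 ≤ ν ∧ 0 ≤ β ∧
      t ≤ D.dualObj y ℓ θ α ν + ∑ k with ℓ k = none, ∑ n, y k n * β k n ∧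
      ∀ n, (D.Aᵀ *ᵥ α) n - ∑ k, ∑ m with ℓ k = some m ∧ n ∈ D.nbr m, x n * ν k
        + ∑ k with ℓ k = none, ∑ m with n ∈ D.nbr m, x n * β k m ≤ θ n := by
  classical
  -- One row for each inequality of `T`, each failing candidate and each cover constraint. Rows of a
  -- kind that does not apply to `ℓ k` read `0 ≤ 0`.
  let G : Fin R ⊕ Fin K ⊕ (Fin K × Fin N) → Fin N → ℝ
    | .inl r, n => D.A r n
    | .inr (.inl k), n => -∑ m with ℓ k = some m ∧ n ∈ D.nbr m, x n
    | .inr (.inr (k, m)), n => if ℓ k = none ∧ n ∈ D.nbr m then x n else 0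
  let h : Fin R ⊕ Fin K ⊕ (Fin K × Fin N) → ℝ
    | .inl r => D.b r
    | .inr (.inl k) => -∑ m with ℓ k = some m, (y k m - 1)
    | .inr (.inr (k, m)) => if ℓ k = none then y k m else 0
  have hinf : ¬ ∃ ξ ∈ Set.Icc (0 : Fin N → ℝ) 1, ∀ i, h i ≤ ∑ n, G i n * ξ n := by
    rintro ⟨ξ, hξ, hh⟩
    have hmem : ξ ∈ D.T := fun r => hh (.inl r)
    refine hℓ _ (D.roundUp_mem_Unc hT hmem hξ) (D.pattern_roundUp hx hy hξ ⟨?_, ?_⟩)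
    · intro k m hk
      have := hh (.inr (.inl k))
      simp only [h, G, hk, Option.some.injEq, neg_mul, Finset.sum_neg_distrib, neg_le_neg_iff,
        Finset.sum_filter, ite_and, Finset.sum_ite_eq, Finset.mem_univ, if_true, ite_mul,
        zero_mul] at this
      rw [← Finset.sum_filter, Finset.filter_mem_eq_inter, Finset.univ_inter] at this
      simpa only [mul_comm] using this
    · intro k hk m
      have := hh (.inr (.inr (k, m)))
      simp only [h, G, hk, true_and, if_true, ite_mul, zero_mul] at this
      rw [← Finset.sum_filter, Finset.filter_mem_eq_inter, Finset.univ_inter] at this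
      simpa only [mul_comm] using this
  obtain ⟨u, θ, hu, hθ, hG, ht⟩ := exists_multipliers_of_infeasible_ge G h hinf t
  refine ⟨θ, fun r => u (.inl r), fun k => u (.inr (.inl k)), fun k m => u (.inr (.inr (k, m))),
    hθ, fun r => hu _, fun k => hu _, fun k m => hu _, ht.trans (le_of_eq ?_),
    fun n => le_trans (le_of_eq ?_) (hG n)⟩
  · simp only [Fintype.sum_sum_type, Fintype.sum_prod_type, h, dualObj, Finset.sum_filter,
      mul_neg, Finset.sum_neg_distrib, Finset.mul_sum, mul_ite, mul_zero]
    have e1 : ∀ k, (∑ m, if ℓ k = none then u (.inr (.inr (k, m))) * y k m else 0)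
        = if ℓ k = none then ∑ m, y k m * u (.inr (.inr (k, m))) else 0 := by
      intro k
      split_ifs <;> simp [mul_comm]
    simp only [e1, mul_comm (u (.inr (.inl _)))]
    ring
  · simp only [Fintype.sum_sum_type, Fintype.sum_prod_type, G, Finset.sum_filter,
      mul_neg, Finset.sum_neg_distrib, Finset.mul_sum, mul_ite, mul_zero]
    have e1 : ∀ k, (∑ m, if ℓ k = none ∧ n ∈ D.nbr m then u (.inr (.inr (k, m))) * x n else 0)
        = if ℓ k = none then ∑ m, (if n ∈ D.nbr m then x n * u (.inr (.inr (k, m))) else 0)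
          else 0 := by
      intro k
      split_ifs with hk <;> simp [hk, mul_comm]
    simp only [e1, mul_comm (u (.inr (.inl _))), Matrix.mulVec, dotProduct,
      Matrix.transpose_apply, mul_comm (D.A _ _)]
    ring

end Data

/-! ### Uniformly bounded certificates -/

namespace Data

variable {N C R K : ℕ} (D : Data N C R)

/-- The dual variables certify the bound `t` for the pattern `ℓ`. -/
def Certifies (t : ℝ) (x : Fin N → ℝ) (y : Fin K → Fin N → ℝ) (ℓ : Idx N K)
    (θ : Fin N → ℝ) (α : Fin R → ℝ) (ν : Fin K → ℝ) (β : Fin K → Fin N → ℝ) : Prop :=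
  0 ≤ θ ∧ 0 ≤ α ∧ 0 ≤ ν ∧ 0 ≤ β ∧
  t ≤ D.dualObj y ℓ θ α ν + ∑ k with ℓ k = none, ∑ n, y k n * β k n ∧
  ∀ n, (D.Aᵀ *ᵥ α) n - ∑ k, ∑ m with ℓ k = some m ∧ n ∈ D.nbr m, x n * ν k
    + ∑ k with ℓ k = none, ∑ m with n ∈ D.nbr m, x n * β k m ≤ θ n

theorem certifies_zero (x : Fin N → ℝ) (y : Fin K → Fin N → ℝ) (ℓ : Idx N K) :
    D.Certifies 0 x y ℓ 0 0 0 0 := by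
  simp [Certifies, dualObj]

/-- If no availability is possible at all, then `α` and `θ` alone certify every bound. -/
theorem exists_certificate_of_Unc_empty (hT : IsUpwardClosed D.T) (hU : D.Unc = ∅)
    (x : Fin N → ℝ) (y : Fin K → Fin N → ℝ) (ℓ : Idx N K) (t : ℝ) :
    ∃ θ α, D.Certifies t x y ℓ θ α 0 0 := by
  have hinf : ¬ ∃ ξ ∈ Set.Icc (0 : Fin N → ℝ) 1, ∀ r, D.b r ≤ ∑ n, D.A r n * ξ n := by
    rintro ⟨ξ, hξ, h⟩
    exact (hU ▸ D.roundUp_mem_Unc hT (ξ := ξ) (fun r => h r) hξ : _ ∈ (∅ : Set _)).elim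
  obtain ⟨α, θ, hα, hθ, hd, ht⟩ := exists_multipliers_of_infeasible_ge D.A D.b hinf t
  refine ⟨θ, α, hθ, hα, le_rfl, le_rfl, by simpa [dualObj] using ht, fun n => ?_⟩
  simpa [Matrix.mulVec, dotProduct, mul_comm] using hd n

/-- The certificates for infeasible patterns can be chosen with uniformly bounded `ν` and `β`. -/
theorem exists_bounded_certificate (hT : IsUpwardClosed D.T) (K : ℕ) (t : ℝ) :
    ∃ M : ℝ, ∀ (x : Fin N → ℝ) (y : Fin K → Fin N → ℝ) (ℓ : Idx N K),
      IsBinary x → (∀ k, IsBinary (y k)) → (∀ ξ ∈ D.Unc, ¬ D.Pattern x y ℓ ξ) →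
      ∃ θ α ν β, D.Certifies t x y ℓ θ α ν β ∧ (∀ k, ν k ≤ M) ∧ ∀ k n, β k n ≤ M := by
  -- Boolean codes turn the choice of `x`, `y` and `ℓ` into a finite index, so the bounds of
  -- individually chosen certificates have a common upper bound.
  have key : ∀ i : (Fin N → Bool) × (Fin K → Fin N → Bool) × Idx N K, ∃ M : ℝ,
      ∀ (x : Fin N → ℝ) (y : Fin K → Fin N → ℝ) (ℓ : Idx N K),
      IsBinary x → (∀ k, IsBinary (y k)) → (x = fun n => if i.1 n then 1 else 0) →
      (y = fun k n => if i.2.1 k n then 1 else 0) → ℓ = i.2.2 →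
      (∀ ξ ∈ D.Unc, ¬ D.Pattern x y ℓ ξ) →
      ∃ θ α ν β, D.Certifies t x y ℓ θ α ν β ∧ (∀ k, ν k ≤ M) ∧ ∀ k n, β k n ≤ M := by
    rintro ⟨p, q, ℓ⟩
    by_cases hb : ∃ (x : Fin N → ℝ) (y : Fin K → Fin N → ℝ), IsBinary x ∧ (∀ k, IsBinary (y k)) ∧
      (x = fun n => if p n then 1 else 0) ∧ (y = fun k n => if q k n then 1 else 0) ∧
      ∀ ξ ∈ D.Unc, ¬ D.Pattern x y ℓ ξ
    · obtain ⟨x, y, hx, hy, rfl, rfl, hℓ⟩ := hb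
      obtain ⟨θ, α, ν, β, hc⟩ := D.exists_certificate hT hx hy hℓ t
      obtain ⟨M₁, h₁⟩ := Finite.exists_le ν
      obtain ⟨M₂, h₂⟩ := Finite.exists_le fun i : Fin K × Fin N => β i.1 i.2
      refine ⟨max M₁ M₂, ?_⟩
      rintro _ _ _ - - rfl rfl rfl -
      exact ⟨θ, α, ν, β, hc, fun k => (h₁ k).trans (le_max_left _ _),
        fun k n => (h₂ (k, n)).trans (le_max_right _ _)⟩
    · refine ⟨0, ?_⟩
      rintro x y _ hx hy hp hq rfl hℓ
      exact (hb ⟨x, y, hx, hy, hp, hq, hℓ⟩).elim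
  choose M hM using key
  obtain ⟨B, hB⟩ := Finite.exists_le M
  refine ⟨B, fun x y ℓ hx hy hℓ => ?_⟩
  obtain ⟨p, hp⟩ := exists_bool_of_isBinary hx
  choose q hq using fun k => exists_bool_of_isBinary (hy k)
  obtain ⟨θ, α, ν, β, hc, h₁, h₂⟩ := hM (p, q, ℓ) x y ℓ hx hy hp (funext hq) rfl hℓ
  exact ⟨θ, α, ν, β, hc, fun k => (h₁ k).trans (hB _), fun k n => (h₂ k n).trans (hB _)⟩

/-! ### Equivalence with the bilinear program -/

/-- A supremum over finitely many `k` of terms strictly below `τ` is strictly below `τ`, also when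
no candidate is justified, because `⊥ < τ`. -/
theorem exists_le_of_le_worstCase {x : Fin N → ℝ} {y : Fin K → Fin N → ℝ} {τ : ℝ}
    (hτ : (τ : EReal) ≤ D.worstCase x y) {ξ : Fin N → ℝ} (hξ : ξ ∈ D.Unc) :
    ∃ k, D.Covers x ξ (y k) ∧ τ ≤ ∑ n, y k n := by
  by_contra! hne
  have h1 : (τ : EReal) ≤ ⨆ (k : Fin K) (_ : D.Covers x ξ (y k)), ((∑ n, y k n : ℝ) : EReal) :=
    hτ.trans (iInf₂_le ξ hξ)
  refine absurd h1 (not_le.2 ?_)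
  have h2 : (Finset.univ.sup fun k : Fin K =>
      ⨆ (_ : D.Covers x ξ (y k)), ((∑ n, y k n : ℝ) : EReal)) < τ := by
    rw [Finset.sup_lt_iff (EReal.bot_lt_coe τ)]
    intro k _
    by_cases hc : D.Covers x ξ (y k)
    · simpa only [hc, iSup_pos] using EReal.coe_lt_coe_iff.2 (hne k hc)
    · simp [hc]
  rwa [Finset.sup_univ_eq_iSup] at h2

/-- Every bound below the worst case is certified by dual variables for which the continuous
factors of all products are uniformly bounded. -/
theorem exists_bounded_duals (hT : IsUpwardClosed D.T) (K : ℕ) :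
    ∃ M : ℝ, ∀ (x : Fin N → ℝ) (y : Fin K → Fin N → ℝ) (τ : ℝ),
      D.FirstStage x y → (τ : EReal) ≤ D.worstCase x y →
      ∃ d : Duals N R K, D.BilinearFeasible τ x y d ∧
        (∀ ℓ k, d.ν ℓ k ≤ M) ∧ (∀ ℓ k n, d.β ℓ k n ≤ M) ∧ ∀ ℓ k, d.lam ℓ k ≤ M := by
  classical
  -- The target `N + 1` covers both kinds of block: it is at least `1`, and at least any `τ`
  -- attainable when `Ξ` is nonempty, as then `τ ≤ N`.
  obtain ⟨M, hM⟩ := D.exists_bounded_certificate hT K (N + 1)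
  refine ⟨max 1 M, fun x y τ hF hτ => ?_⟩
  have hx := hF.1.1
  have hy := fun k => (hF.2 k).1
  have hM0 : (0 : ℝ) ≤ max 1 M := zero_le_one.trans (le_max_left _ _)
  have hcert : ∀ ℓ : Idx N K, ∃ θ α ν β t, D.Certifies t x y ℓ θ α ν β ∧
      (∀ k, ν k ≤ max 1 M) ∧ (∀ k n, β k n ≤ max 1 M) ∧
      ((∀ k, ℓ k ≠ none) → 1 ≤ t) ∧ ((∃ k, ℓ k = none) → ∃ k, ℓ k = none ∧
        τ ≤ t + ∑ n, y k n) := by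
    intro ℓ
    have hy0 : ∀ k, 0 ≤ ∑ n, y k n := fun k => Finset.sum_nonneg fun n _ => (hy k).nonneg n
    by_cases hU : D.Unc = ∅
    -- With `Ξ` empty, `τ` is unbounded and the certificate must depend on it. Since `ν` and `β`
    -- vanish, the bound on the product factors is unaffected.
    · obtain ⟨θ, α, hc⟩ := D.exists_certificate_of_Unc_empty hT hU x y ℓ (max 1 τ)
      refine ⟨θ, α, 0, 0, _, hc, fun _ => hM0, fun _ _ => hM0, fun _ => le_max_left _ _, ?_⟩
      rintro ⟨k, hk⟩
      exact ⟨k, hk, by linarith [hy0 k, le_max_right 1 τ]⟩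
    · by_cases hp : ∃ ξ ∈ D.Unc, D.Pattern x y ℓ ξ
      · obtain ⟨ξ, hξ, hp⟩ := hp
        obtain ⟨k, hc, hk⟩ := D.exists_le_of_le_worstCase hτ hξ
        have hk' := (D.covers_iff_of_pattern hp k).1 hc
        -- For a realized pattern the zero duals suffice: a justified candidate already reaches `τ`,
        -- and `λ` will be its unit vector.
        exact ⟨0, 0, 0, 0, 0, D.certifies_zero x y ℓ, fun _ => hM0, fun _ _ => hM0,
          fun h => (h k hk').elim, fun _ => ⟨k, hk', by linarith⟩⟩
      · obtain ⟨θ, α, ν, β, hc, h₁, h₂⟩ := hM x y ℓ hx hy fun ξ hξ h => hp ⟨ξ, hξ, h⟩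
        refine ⟨θ, α, ν, β, _, hc, fun k => (h₁ k).trans (le_max_right _ _),
          fun k n => (h₂ k n).trans (le_max_right _ _), fun _ => by simp, ?_⟩
        rintro ⟨k, hk⟩
        obtain ⟨ξ, hξ⟩ := Set.nonempty_iff_ne_empty.2 hU
        obtain ⟨k', -, hk'⟩ := D.exists_le_of_le_worstCase hτ hξ
        have : ∑ n, y k' n ≤ N := by
          simpa using Finset.sum_le_sum fun n (_ : n ∈ Finset.univ) => (hy k').le_one n
        exact ⟨k, hk, by linarith [hy0 k]⟩
  choose θ α ν β t hc hν hβ h1 h0 using hcert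
  choose κ hκ hτκ using fun ℓ : Idx0 N K => h0 ℓ.1 ℓ.2
  refine ⟨⟨θ, α, ν, fun ℓ => β ℓ.1, fun ℓ => Pi.single (κ ℓ) 1⟩, ⟨hF, fun ℓ => ?_, fun ℓ => ?_⟩,
    hν, fun ℓ => hβ ℓ.1, fun ℓ k => ?_⟩
  · obtain ⟨c1, c2, c3, c4, c5, c6⟩ := hc ℓ.1
    refine ⟨c1, c2, c3, c4, ⟨Pi.single_nonneg.2 zero_le_one, by simp, fun k hk => ?_⟩, ?_, c6⟩
    · exact Pi.single_eq_of_ne (by rintro rfl; exact hk (hκ ℓ)) _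
    · have : ∑ k, (Pi.single (κ ℓ) (1 : ℝ) : Fin K → ℝ) k * ∑ n, y k n = ∑ n, y (κ ℓ) n := by
        simp [Pi.single_apply]
      simp only [this]
      linarith [hτκ ℓ]
  · obtain ⟨c1, c2, c3, c4, c5, c6⟩ := hc ℓ.1
    have he : (Finset.univ.filter fun k => ℓ.1 k = none) = ∅ :=
      Finset.filter_eq_empty_iff.2 fun k _ => ℓ.2 k
    simp only [he, Finset.sum_empty, add_zero] at c5 c6
    exact ⟨c1, c2, c3, (h1 ℓ.1 ℓ.2).trans c5, c6⟩
  · refine le_trans ?_ (le_max_left _ _)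
    by_cases h : k = κ ℓ <;> simp [h]

/-- Weak duality for a pattern of `ξ` leaves `τ` below a convex combination of the values of
justified candidates, so one of them reaches `τ`. For a positive pattern it would give `1 ≤ 0`. -/
theorem le_worstCase_of_bilinearFeasible {τ : ℝ} {x : Fin N → ℝ} {y : Fin K → Fin N → ℝ}
    {d : Duals N R K} (h : D.BilinearFeasible τ x y d) : (τ : EReal) ≤ D.worstCase x y := by
  obtain ⟨hF, h0, h1⟩ := h
  refine le_iInf₂ fun ξ hξ => ?_
  obtain ⟨ℓ, hℓ⟩ := D.exists_pattern hF.1.1 (fun k => (hF.2 k).1) hξ.1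
  by_cases hz : ∃ k, ℓ k = none
  · obtain ⟨b1, b2, b3, b4, ⟨l1, l2, l3⟩, b5, b6⟩ := h0 ⟨ℓ, hz⟩
    have hd := D.dual_le_of_pattern hξ hℓ b1 b2 b3 b4 b6
    have hτ : τ ≤ ∑ k, d.lam ⟨ℓ, hz⟩ k * ∑ n, y k n := by linarith
    have : ∃ k, ℓ k = none ∧ τ ≤ ∑ n, y k n := by
      by_contra! hne
      obtain ⟨k₀, -, hk₀⟩ : ∃ k ∈ Finset.univ, (0 : ℝ) < d.lam ⟨ℓ, hz⟩ k :=
        Finset.exists_lt_of_sum_lt (by simp [l2])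
      have hle : ∀ k, d.lam ⟨ℓ, hz⟩ k * ∑ n, y k n ≤ d.lam ⟨ℓ, hz⟩ k * τ := by
        intro k
        by_cases hk : ℓ k = none
        · exact mul_le_mul_of_nonneg_left (hne k hk).le (l1 k)
        · simp [l3 k hk]
      have hlt : ∑ k, d.lam ⟨ℓ, hz⟩ k * ∑ n, y k n < ∑ k, d.lam ⟨ℓ, hz⟩ k * τ := by
        refine Finset.sum_lt_sum (fun k _ => hle k) ⟨k₀, Finset.mem_univ _, ?_⟩
        refine mul_lt_mul_of_pos_left (hne k₀ ?_) hk₀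
        by_contra hk
        exact hk₀.ne' (l3 k₀ hk)
      rw [← Finset.sum_mul, l2, one_mul] at hlt
      linarith
    obtain ⟨k, hk, hτk⟩ := this
    exact le_iSup₂_of_le k (hℓ.2 k hk) (EReal.coe_le_coe_iff.2 hτk)
  · have hz : ∀ k, ℓ k ≠ none := not_exists.1 hz
    obtain ⟨b1, b2, b3, b4, b5⟩ := h1 ⟨ℓ, hz⟩
    have he : (Finset.univ.filter fun k => ℓ k = none) = ∅ :=
      Finset.filter_eq_empty_iff.2 fun k _ => hz k
    have hd := D.dual_le_of_pattern hξ hℓ b1 b2 b3 (β := 0) le_rfl (fun n => by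
      simpa only [he, Finset.sum_empty, add_zero] using b5 n)
    simp only [he, Finset.sum_empty, add_zero] at hd
    exact absurd (b4.trans hd) (by norm_num)

theorem exists_bilinearFeasible_iff (hT : IsUpwardClosed D.T) (x : Fin N → ℝ)
    (y : Fin K → Fin N → ℝ) (τ : ℝ) :
    (∃ d : Duals N R K, D.BilinearFeasible τ x y d) ↔
      D.FirstStage x y ∧ (τ : EReal) ≤ D.worstCase x y := by
  refine ⟨fun ⟨d, h⟩ => ⟨h.1, D.le_worstCase_of_bilinearFeasible h⟩, fun ⟨hF, hτ⟩ => ?_⟩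
  obtain ⟨M, hM⟩ := D.exists_bounded_duals hT K
  obtain ⟨d, hd, -⟩ := hM x y τ hF hτ
  exact ⟨d, hd⟩

theorem le_bilinearValue {τ : ℝ} {x : Fin N → ℝ} {y : Fin K → Fin N → ℝ} {d : Duals N R K}
    (h : D.BilinearFeasible τ x y d) : (τ : EReal) ≤ D.bilinearValue K :=
  le_iSup_of_le τ <| le_iSup_of_le x <| le_iSup_of_le y <| le_iSup_of_le d <|
    le_iSup_of_le h le_rfl

theorem bilinearValue_le {B : EReal} (h : ∀ (τ : ℝ) (x : Fin N → ℝ) (y : Fin K → Fin N → ℝ)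
    (d : Duals N R K), D.BilinearFeasible τ x y d → (τ : EReal) ≤ B) : D.bilinearValue K ≤ B :=
  iSup_le fun τ => iSup_le fun x => iSup_le fun y => iSup_le fun d => iSup_le fun hd =>
    h τ x y d hd

theorem worstCase_le_adaptValue {x : Fin N → ℝ} {y : Fin K → Fin N → ℝ} (h : D.FirstStage x y) :
    D.worstCase x y ≤ D.adaptValue K :=
  le_iSup_of_le x <| le_iSup_of_le y <| le_iSup_of_le h le_rfl

theorem adaptValue_eq_bilinearValue (hT : IsUpwardClosed D.T) (K : ℕ) :
    D.adaptValue K = D.bilinearValue K := by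
  refine le_antisymm (iSup_le fun x => iSup_le fun y => iSup_le fun hF => ?_)
    (D.bilinearValue_le fun τ x y d h =>
      (D.le_worstCase_of_bilinearFeasible h).trans (D.worstCase_le_adaptValue h.1))
  -- The worst case is `⊤` when `Ξ` is empty, and no real `τ` attains it; comparing through all
  -- smaller reals covers this case too.
  refine EReal.ge_of_forall_gt_iff_ge.1 fun τ hτ => ?_
  obtain ⟨d, hd⟩ := (D.exists_bilinearFeasible_iff hT x y τ).2 ⟨hF, hτ.le⟩
  exact D.le_bilinearValue hd

theorem isOptimal_iff (hT : IsUpwardClosed D.T) (x : Fin N → ℝ) (y : Fin K → Fin N → ℝ) (τ : ℝ) :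
    (D.FirstStage x y ∧ D.worstCase x y = (τ : EReal) ∧ D.adaptValue K = (τ : EReal)) ↔
      ∃ d : Duals N R K, D.BilinearFeasible τ x y d ∧
        ∀ (τ' : ℝ) (x' : Fin N → ℝ) (y' : Fin K → Fin N → ℝ) (d' : Duals N R K),
          D.BilinearFeasible τ' x' y' d' → τ' ≤ τ := by
  rw [D.adaptValue_eq_bilinearValue hT]
  constructor
  · rintro ⟨hF, hw, ha⟩
    obtain ⟨d, hd⟩ := (D.exists_bilinearFeasible_iff hT x y τ).2 ⟨hF, hw.ge⟩
    exact ⟨d, hd, fun τ' x' y' d' h => EReal.coe_le_coe_iff.1 (ha ▸ D.le_bilinearValue h)⟩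
  · rintro ⟨d, hd, hmax⟩
    have hv : D.bilinearValue K = (τ : EReal) :=
      le_antisymm (D.bilinearValue_le fun τ' x' y' d' h =>
        EReal.coe_le_coe_iff.2 (hmax τ' x' y' d' h)) (D.le_bilinearValue hd)
    refine ⟨hd.1, le_antisymm ?_ (D.le_worstCase_of_bilinearFeasible hd), hv⟩
    exact (D.worstCase_le_adaptValue hd.1).trans
      ((D.adaptValue_eq_bilinearValue hT K).trans hv).le

end Data

/-! ### Counting variables and constraints -/

/-- The kind of a product together with its indices. -/
def productCode {N K : ℕ} : Product N K →
    Fin 5 × Idx N K × Fin K × Fin N × Option (Fin N)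
  | .xν ℓ n k => (0, ℓ, k, n, none)
  | .yν ℓ k n => (1, ℓ, k, n, none)
  | .xβ ℓ n k m => (2, ℓ.1, k, n, some m)
  | .yβ ℓ k n => (3, ℓ.1, k, n, none)
  | .ylam ℓ k n => (4, ℓ.1, k, n, none)

theorem productCode_injective {N K : ℕ} : Function.Injective (productCode (N := N) (K := K)) := by
  intro a b h
  cases a <;> cases b <;> simp [productCode, Subtype.ext_iff] at h ⊢ <;> tauto

/-- The kind of a variable of the bilinear program together with its indices. -/
def baseVarCode {N R K : ℕ} : BaseVar N R K →
    Fin 8 × Option (Idx N K) × Option (Fin K) × Option (Fin N) × Option (Fin R)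
  | .τ => (0, none, none, none, none)
  | .x n => (1, none, none, some n, none)
  | .y k n => (2, none, some k, some n, none)
  | .θ ℓ n => (3, some ℓ, none, some n, none)
  | .α ℓ r => (4, some ℓ, none, none, some r)
  | .ν ℓ k => (5, some ℓ, some k, none, none)
  | .β ℓ k n => (6, some ℓ.1, some k, some n, none)
  | .lam ℓ k => (7, some ℓ.1, some k, none, none)

theorem baseVarCode_injective {N R K : ℕ} :
    Function.Injective (baseVarCode (N := N) (R := R) (K := K)) := by
  intro a b h
  cases a <;> cases b <;> simp [baseVarCode, Subtype.ext_iff] at h ⊢ <;> tauto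

/-- The kind of an inequality of the MILP together with its indices. -/
def ineqCode {N C R K : ℕ} : Ineq N C R K →
    (Fin 18 × Option (Idx N K) × Option (Fin K) × Option (Fin N) × Option (Fin C) ×
      Option (Fin R)) ⊕ (Fin 4 × Product N K)
  | .xNonneg n => .inl (0, none, none, some n, none, none)
  | .xLeOne n => .inl (1, none, none, some n, none, none)
  | .yNonneg k n => .inl (2, none, some k, some n, none, none)
  | .yLeOne k n => .inl (3, none, some k, some n, none, none)
  | .budget => .inl (4, none, none, none, none, none)
  | .fair k c => .inl (5, none, some k, none, some c, none)
  | .θNonneg ℓ n => .inl (6, some ℓ, none, some n, none, none)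
  | .αNonneg ℓ r => .inl (7, some ℓ, none, none, none, some r)
  | .νNonneg ℓ k => .inl (8, some ℓ, some k, none, none, none)
  | .βNonneg ℓ k n => .inl (9, some ℓ.1, some k, some n, none, none)
  | .lamNonneg ℓ k => .inl (10, some ℓ.1, some k, none, none, none)
  | .lamSumLe ℓ => .inl (11, some ℓ.1, none, none, none, none)
  | .lamSumGe ℓ => .inl (12, some ℓ.1, none, none, none, none)
  | .lamZero ℓ k => .inl (13, some ℓ.1, some k, none, none, none)
  | .epi ℓ => .inl (14, some ℓ.1, none, none, none, none)
  | .dualZero ℓ n => .inl (15, some ℓ.1, none, some n, none, none)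
  | .cert ℓ => .inl (16, some ℓ.1, none, none, none, none)
  | .dualPos ℓ n => .inl (17, some ℓ.1, none, some n, none, none)
  | .prodNonneg p => .inr (0, p)
  | .prodLeBin p => .inr (1, p)
  | .prodLeCont p => .inr (2, p)
  | .prodGe p => .inr (3, p)

theorem ineqCode_injective {N C R K : ℕ} :
    Function.Injective (ineqCode (N := N) (C := C) (R := R) (K := K)) := by
  intro a b h
  cases a <;> cases b <;> simp [ineqCode, Subtype.ext_iff] at h ⊢ <;> tauto

instance {N K : ℕ} : Finite (Product N K) := Finite.of_injective _ productCode_injective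

instance {N R K : ℕ} : Finite (BaseVar N R K) := Finite.of_injective _ baseVarCode_injective

instance {N C R K : ℕ} : Finite (Ineq N C R K) := Finite.of_injective _ ineqCode_injective

theorem card_idx (N K : ℕ) : Nat.card (Idx N K) = (N + 1) ^ K := by
  simp [Nat.card_eq_fintype_card]

theorem card_product_le (N K : ℕ) :
    Nat.card (Product N K) ≤ 5 * ((N + 1) ^ K * (K * (N * (N + 1)))) := by
  simpa [Nat.card_eq_fintype_card] using Nat.card_le_card_of_injective _
    (productCode_injective (N := N) (K := K))

theorem card_baseVar_le (N R K : ℕ) :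
    Nat.card (BaseVar N R K) ≤ 8 * (((N + 1) ^ K + 1) * ((K + 1) * ((N + 1) * (R + 1)))) := by
  simpa [Nat.card_eq_fintype_card] using Nat.card_le_card_of_injective _
    (baseVarCode_injective (N := N) (R := R) (K := K))

theorem card_ineq_le (N C R K : ℕ) :
    Nat.card (Ineq N C R K) ≤
      18 * (((N + 1) ^ K + 1) * ((K + 1) * ((N + 1) * ((C + 1) * (R + 1)))))
        + 4 * Nat.card (Product N K) := by
  have := Nat.card_le_card_of_injective _
    (ineqCode_injective (N := N) (C := C) (R := R) (K := K))
  rw [Nat.card_sum] at this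
  simpa [Nat.card_prod, Nat.card_eq_fintype_card (α := Option _), Finite.card_option] using this

/-- Each index owns exactly one row `epi` or `cert`, according to whether it has a zero component.
-/
theorem card_idx_le_card_ineq (N C R K : ℕ) : (N + 1) ^ K ≤ Nat.card (Ineq N C R K) := by
  classical
  rw [← card_idx]
  let f : Idx N K → Ineq N C R K := fun ℓ =>
    if h : ∃ k, ℓ k = none then .epi ⟨ℓ, h⟩ else .cert ⟨ℓ, not_exists.1 h⟩
  refine Nat.card_le_card_of_injective f fun a b hab => ?_
  by_cases ha : ∃ k, a k = none <;> by_cases hb : ∃ k, b k = none <;>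
    simp_all [f]

theorem card_bigM_le {N C R : ℕ} (D : Data N C R) (K : ℕ) (M : ℝ) :
    (D.bigM K M).numVars + (D.bigM K M).numCons ≤
      (100 * (N + 1) ^ 2 * (C + 1) * (R + 1) * (K + 1)) * (N + 1) ^ K := by
  have h1 := card_product_le N K
  have h2 := card_baseVar_le N R K
  have h3 := card_ineq_le N C R K
  have h4 : (D.bigM K M).numVars = Nat.card (BaseVar N R K) + Nat.card (Product N K) :=
    Nat.card_sum
  have h5 : (D.bigM K M).numCons = Nat.card (Ineq N C R K) := rfl
  have hL : 1 ≤ (N + 1) ^ K := Nat.one_le_pow _ _ (by omega)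
  rw [h4, h5]
  generalize (N + 1) ^ K = L at *
  have hr : 1 ≤ (C + 1) * (R + 1) := Nat.one_le_iff_ne_zero.2 (by positivity)
  have hn : 1 ≤ N + 1 := by omega
  have e1 : L * (K * (N * (N + 1))) ≤ (N + 1) ^ 2 * (C + 1) * (R + 1) * (K + 1) * L := by
    calc L * (K * (N * (N + 1))) ≤ L * ((K + 1) * ((N + 1) * (N + 1))) := by gcongr <;> omega
      _ = (N + 1) ^ 2 * (K + 1) * L * 1 := by ring
      _ ≤ (N + 1) ^ 2 * (K + 1) * L * ((C + 1) * (R + 1)) := by gcongr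
      _ = _ := by ring
  have e3 : (L + 1) * ((K + 1) * ((N + 1) * ((C + 1) * (R + 1)))) ≤
      2 * ((N + 1) ^ 2 * (C + 1) * (R + 1) * (K + 1) * L) := by
    calc (L + 1) * ((K + 1) * ((N + 1) * ((C + 1) * (R + 1))))
        ≤ (L + L) * ((K + 1) * ((N + 1) * ((C + 1) * (R + 1)))) := by gcongr
      _ = 2 * L * (K + 1) * (N + 1) * (C + 1) * (R + 1) * 1 := by ring
      _ ≤ 2 * L * (K + 1) * (N + 1) * (C + 1) * (R + 1) * (N + 1) := by gcongr
      _ = _ := by ring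
  have e2 : (L + 1) * ((K + 1) * ((N + 1) * (R + 1))) ≤
      (L + 1) * ((K + 1) * ((N + 1) * ((C + 1) * (R + 1)))) := by
    gcongr
    exact Nat.le_mul_of_pos_left _ (by omega)
  have e4 : 100 * (N + 1) ^ 2 * (C + 1) * (R + 1) * (K + 1) * L =
    100 * ((N + 1) ^ 2 * (C + 1) * (R + 1) * (K + 1) * L) := by ring
  rw [e4]
  -- In multiples of the common factor, variables contribute at most `16 + 5` and constraints `36 +
  -- 20`, in total `77 ≤ 100`.
  omega

/-! ### The Big-M linearization -/

namespace Data

variable {N C R K : ℕ} (D : Data N C R)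

theorem base_apply (v : BaseVar N R K) (z : Var N R K → ℝ) : base v z = z (Sum.inl v) := rfl

theorem prd_apply (p : Product N K) (z : Var N R K → ℝ) : prd p z = z (Sum.inr p) := rfl

/-- The variables of the products agree with the products. -/
def IsExact (z : Var N R K → ℝ) : Prop :=
  ∀ p : Product N K, z (Sum.inr p) = z (Sum.inl (p.bin R)) * z (Sum.inl (p.cont R))

theorem bin_eq_zero_or_one {M : ℝ} {z : Var N R K → ℝ} (h : (D.bigM K M).Feasible z)
    {v : BaseVar N R K} (hv : Sum.inl v ∈ (D.bigM K M).integral) (h0 : 0 ≤ z (Sum.inl v))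
    (h1 : z (Sum.inl v) ≤ 1) : z (Sum.inl v) = 0 ∨ z (Sum.inl v) = 1 := by
  obtain ⟨i, hi⟩ := h.2 _ hv
  rw [hi] at h0 h1 ⊢
  have h0 : 0 ≤ i := by exact_mod_cast h0
  have h1 : i ≤ 1 := by exact_mod_cast h1
  obtain rfl | rfl : i = 0 ∨ i = 1 := by omega
  all_goals simp

theorem isBinary_xPart {M : ℝ} {z : Var N R K → ℝ} (h : (D.bigM K M).Feasible z) :
    IsBinary (xPart z) := fun n =>
  D.bin_eq_zero_or_one h (Or.inl ⟨n, rfl⟩)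
    (by simpa [bigM, milpRow, milpRhs, base_apply] using h.1 (.xNonneg n))
    (by simpa [bigM, milpRow, milpRhs, base_apply] using h.1 (.xLeOne n))

theorem isBinary_yPart {M : ℝ} {z : Var N R K → ℝ} (h : (D.bigM K M).Feasible z) (k : Fin K) :
    IsBinary (yPart z k) := fun n =>
  D.bin_eq_zero_or_one h (Or.inr ⟨k, n, rfl⟩)
    (by simpa [bigM, milpRow, milpRhs, base_apply] using h.1 (.yNonneg k n))
    (by simpa [bigM, milpRow, milpRhs, base_apply] using h.1 (.yLeOne k n))

/-- True for every `M`: a binary factor `0` squeezes the product variable between `0` and `0`, a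
factor `1` between `v` and `v`. Only the converse direction needs `M` large. -/
theorem isExact_of_feasible {M : ℝ} {z : Var N R K → ℝ} (h : (D.bigM K M).Feasible z) :
    IsExact z := by
  intro p
  have h1 := h.1 (.prodNonneg p)
  have h2 := h.1 (.prodLeBin p)
  have h3 := h.1 (.prodLeCont p)
  have h4 := h.1 (.prodGe p)
  simp only [bigM, milpRow, milpRhs, base_apply, prd_apply, LinearMap.neg_apply,
    LinearMap.sub_apply, LinearMap.add_apply, LinearMap.smul_apply, smul_eq_mul] at h1 h2 h3 h4
  have hb : z (Sum.inl (p.bin R)) = 0 ∨ z (Sum.inl (p.bin R)) = 1 := by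
    cases p
    · exact D.isBinary_xPart h _
    · exact D.isBinary_yPart h _ _
    · exact D.isBinary_xPart h _
    · exact D.isBinary_yPart h _ _
    · exact D.isBinary_yPart h _ _
  rcases hb with hb | hb <;> rw [hb] at h2 h4 ⊢ <;> linarith

/-- On exact points the linear rows take the values of the bilinear expressions; these evaluations
serve both directions of the equivalence. -/
theorem negDualObjRow_apply {z : Var N R K → ℝ} (h : IsExact z) (ℓ : Idx N K) :
    D.negDualObjRow ℓ z = -D.dualObj (yPart z) ℓ ((dualPart z).θ ℓ) ((dualPart z).α ℓ)
      ((dualPart z).ν ℓ) := by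
  simp only [negDualObjRow, dualObj, LinearMap.sub_apply, LinearMap.add_apply,
    LinearMap.sum_apply, LinearMap.smul_apply, base_apply, prd_apply, smul_eq_mul, h _,
    Product.bin, Product.cont, dualPart, yPart, sub_mul, one_mul, mul_comm (D.b _)]
  ring

theorem dualZero_apply (M : ℝ) {z : Var N R K → ℝ} (h : IsExact z) (ℓ : Idx0 N K) (n : Fin N) :
    D.milpRow M (.dualZero ℓ n) z = (D.Aᵀ *ᵥ (dualPart z).α ℓ) n
      - ∑ k, ∑ m with ℓ.1 k = some m ∧ n ∈ D.nbr m, xPart z n * (dualPart z).ν ℓ k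
      + ∑ k with ℓ.1 k = none, ∑ m with n ∈ D.nbr m, xPart z n * (dualPart z).β ℓ k m
      - (dualPart z).θ ℓ n := by
  simp only [milpRow, LinearMap.sub_apply, LinearMap.add_apply,
    LinearMap.sum_apply, LinearMap.smul_apply, base_apply, prd_apply, smul_eq_mul, h _,
    Product.bin, Product.cont, dualPart, xPart, Matrix.mulVec, dotProduct, Matrix.transpose_apply]

theorem dualPos_apply (M : ℝ) {z : Var N R K → ℝ} (h : IsExact z) (ℓ : IdxPos N K) (n : Fin N) :
    D.milpRow M (.dualPos ℓ n) z = (D.Aᵀ *ᵥ (dualPart z).α ℓ) n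
      - ∑ k, ∑ m with ℓ.1 k = some m ∧ n ∈ D.nbr m, xPart z n * (dualPart z).ν ℓ k
      - (dualPart z).θ ℓ n := by
  simp only [milpRow, LinearMap.sub_apply,
    LinearMap.sum_apply, LinearMap.smul_apply, base_apply, prd_apply, smul_eq_mul, h _,
    Product.bin, Product.cont, dualPart, xPart, Matrix.mulVec, dotProduct, Matrix.transpose_apply]

theorem epi_apply (M : ℝ) {z : Var N R K → ℝ} (h : IsExact z) (ℓ : Idx0 N K) :
    D.milpRow M (.epi ℓ) z = z (Sum.inl .τ) - (D.dualObj (yPart z) ℓ ((dualPart z).θ ℓ)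
      ((dualPart z).α ℓ) ((dualPart z).ν ℓ)
      + ∑ k with ℓ.1 k = none, ∑ n, yPart z k n * (dualPart z).β ℓ k n
      + ∑ k, (dualPart z).lam ℓ k * ∑ n, yPart z k n) := by
  simp only [milpRow, LinearMap.sub_apply, LinearMap.add_apply, D.negDualObjRow_apply h,
    LinearMap.sum_apply, base_apply, prd_apply, h _, Finset.sum_mul,
    Product.bin, Product.cont, dualPart, yPart, mul_comm (z (Sum.inl (.lam _ _)))]
  ring

theorem cert_apply (M : ℝ) {z : Var N R K → ℝ} (h : IsExact z) (ℓ : IdxPos N K) :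
    D.milpRow M (.cert ℓ) z = -D.dualObj (yPart z) ℓ ((dualPart z).θ ℓ) ((dualPart z).α ℓ)
      ((dualPart z).ν ℓ) :=
  D.negDualObjRow_apply h ℓ

theorem bilinearFeasible_of_feasible {M : ℝ} {z : Var N R K → ℝ} (h : (D.bigM K M).Feasible z) :
    D.BilinearFeasible ((D.bigM K M).obj z) (xPart z) (yPart z) (dualPart z) := by
  have he := D.isExact_of_feasible h
  have hr : ∀ c, D.milpRow M c z ≤ D.milpRhs M c := h.1
  have hθ : ∀ ℓ, 0 ≤ (dualPart z).θ ℓ := fun ℓ n => by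
    simpa [milpRow, milpRhs, base_apply, xPart, yPart, dualPart] using hr (.θNonneg ℓ n)
  have hα : ∀ ℓ, 0 ≤ (dualPart z).α ℓ := fun ℓ n => by
    simpa [milpRow, milpRhs, base_apply, xPart, yPart, dualPart] using hr (.αNonneg ℓ n)
  have hν : ∀ ℓ, 0 ≤ (dualPart z).ν ℓ := fun ℓ n => by
    simpa [milpRow, milpRhs, base_apply, xPart, yPart, dualPart] using hr (.νNonneg ℓ n)
  refine ⟨⟨⟨D.isBinary_xPart h, ?_⟩, fun k => ⟨D.isBinary_yPart h k, fun c => ?_⟩⟩, fun ℓ => ?_,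
    fun ℓ => ?_⟩
  · simpa [milpRow, milpRhs, base_apply, xPart, yPart, dualPart] using hr .budget
  · simpa [milpRow, milpRhs, base_apply, xPart, yPart, dualPart] using hr (.fair k c)
  · have hlam : 0 ≤ (dualPart z).lam ℓ := fun k => by
      simpa [milpRow, milpRhs, base_apply, xPart, yPart, dualPart] using hr (.lamNonneg ℓ k)
    refine ⟨hθ ℓ, hα ℓ, hν ℓ, fun k n => ?_, ⟨hlam, le_antisymm ?_ ?_, fun k hk => ?_⟩, ?_,
      fun n => ?_⟩
    · simpa [milpRow, milpRhs, base_apply, xPart, yPart, dualPart] using hr (.βNonneg ℓ k n)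
    · simpa [milpRow, milpRhs, base_apply, xPart, yPart, dualPart] using hr (.lamSumLe ℓ)
    · simpa [milpRow, milpRhs, base_apply, xPart, yPart, dualPart] using hr (.lamSumGe ℓ)
    · refine le_antisymm ?_ (hlam k)
      simpa [milpRow, milpRhs, base_apply, xPart, yPart, dualPart, hk] using hr (.lamZero ℓ k)
    · have := hr (.epi ℓ)
      rw [D.epi_apply M he] at this
      exact sub_nonpos.1 this
    · have := hr (.dualZero ℓ n)
      rw [D.dualZero_apply M he] at this
      exact sub_nonpos.1 this
  · refine ⟨hθ ℓ, hα ℓ, hν ℓ, ?_, fun n => ?_⟩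
    · have := hr (.cert ℓ)
      rw [D.cert_apply M he] at this
      exact neg_le_neg_iff.1 this
    · have := hr (.dualPos ℓ n)
      rw [D.dualPos_apply M he] at this
      exact sub_nonpos.1 this

/-- The values of the variables of the bilinear program at a point. -/
def baseValue (τ : ℝ) (x : Fin N → ℝ) (y : Fin K → Fin N → ℝ) (d : Duals N R K) :
    BaseVar N R K → ℝ
  | .τ => τ
  | .x n => x n
  | .y k n => y k n
  | .θ ℓ n => d.θ ℓ n
  | .α ℓ r => d.α ℓ r
  | .ν ℓ k => d.ν ℓ k
  | .β ℓ k n => d.β ℓ k n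
  | .lam ℓ k => d.lam ℓ k

/-- The point of the MILP that belongs to a point of the bilinear program. -/
def lift (τ : ℝ) (x : Fin N → ℝ) (y : Fin K → Fin N → ℝ) (d : Duals N R K) : Var N R K → ℝ
  | .inl v => baseValue τ x y d v
  | .inr p => baseValue τ x y d (p.bin R) * baseValue τ x y d (p.cont R)

/-- The size of `M` matters in two rows: `prodLeBin` at binary factor `1` and `prodGe` at `0` both
ask that the continuous factor be at most `M`. -/
theorem feasible_lift {M τ : ℝ} {x : Fin N → ℝ} {y : Fin K → Fin N → ℝ} {d : Duals N R K}
    (h : D.BilinearFeasible τ x y d) (hν : ∀ ℓ k, d.ν ℓ k ≤ M) (hβ : ∀ ℓ k n, d.β ℓ k n ≤ M)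
    (hlam : ∀ ℓ k, d.lam ℓ k ≤ M) : (D.bigM K M).Feasible (lift τ x y d) := by
  obtain ⟨hF, h0, h1⟩ := h
  have hx := hF.1.1
  have hy := fun k => (hF.2 k).1
  have he : IsExact (lift τ x y d) := fun p => rfl
  have hblock : ∀ ℓ : Idx N K, 0 ≤ d.θ ℓ ∧ 0 ≤ d.α ℓ ∧ 0 ≤ d.ν ℓ := by
    intro ℓ
    by_cases hz : ∃ k, ℓ k = none
    · exact ⟨(h0 ⟨ℓ, hz⟩).1, (h0 ⟨ℓ, hz⟩).2.1, (h0 ⟨ℓ, hz⟩).2.2.1⟩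
    · exact ⟨(h1 ⟨ℓ, not_exists.1 hz⟩).1, (h1 ⟨ℓ, not_exists.1 hz⟩).2.1,
        (h1 ⟨ℓ, not_exists.1 hz⟩).2.2.1⟩
  have hbin : ∀ p : Product N K, baseValue τ x y d (p.bin R) = 0 ∨
      baseValue τ x y d (p.bin R) = 1 := by
    intro p
    cases p
    · exact hx _
    · exact hy _ _
    · exact hx _
    · exact hy _ _
    · exact hy _ _
  have hcont : ∀ p : Product N K, 0 ≤ baseValue τ x y d (p.cont R) ∧
      baseValue τ x y d (p.cont R) ≤ M := by
    intro p
    cases p with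
    | xν ℓ n k => exact ⟨(hblock ℓ).2.2 k, hν ℓ k⟩
    | yν ℓ k n => exact ⟨(hblock ℓ).2.2 k, hν ℓ k⟩
    | xβ ℓ n k m => exact ⟨(h0 ℓ).2.2.2.1 k m, hβ ℓ k m⟩
    | yβ ℓ k n => exact ⟨(h0 ℓ).2.2.2.1 k n, hβ ℓ k n⟩
    | ylam ℓ k n => exact ⟨(h0 ℓ).2.2.2.2.1.1 k, hlam ℓ k⟩
  refine ⟨fun c => ?_, ?_⟩
  · change D.milpRow M c (lift τ x y d) ≤ D.milpRhs M c
    cases c with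
    | xNonneg n => simpa [milpRow, milpRhs, base_apply, lift, baseValue] using hx.nonneg n
    | xLeOne n => exact hx.le_one n
    | yNonneg k n => simpa [milpRow, milpRhs, base_apply, lift, baseValue] using (hy k).nonneg n
    | yLeOne k n => exact (hy k).le_one n
    | budget => simpa [milpRow, milpRhs, base_apply, lift, baseValue] using hF.1.2
    | fair k c => simpa [milpRow, milpRhs, base_apply, lift, baseValue] using (hF.2 k).2 c
    | θNonneg ℓ n => simpa [milpRow, milpRhs, base_apply, lift, baseValue] using (hblock ℓ).1 n
    | αNonneg ℓ r => simpa [milpRow, milpRhs, base_apply, lift, baseValue] using (hblock ℓ).2.1 r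
    | νNonneg ℓ k => simpa [milpRow, milpRhs, base_apply, lift, baseValue] using (hblock ℓ).2.2 k
    | βNonneg ℓ k n => simpa [milpRow, milpRhs, base_apply, lift, baseValue] using (h0 ℓ).2.2.2.1 k n
    | lamNonneg ℓ k => simpa [milpRow, milpRhs, base_apply, lift, baseValue] using (h0 ℓ).2.2.2.2.1.1 k
    | lamSumLe ℓ => simpa [milpRow, milpRhs, base_apply, lift, baseValue] using (h0 ℓ).2.2.2.2.1.2.1.le
    | lamSumGe ℓ => simpa [milpRow, milpRhs, base_apply, lift, baseValue] using (h0 ℓ).2.2.2.2.1.2.1.ge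
    | lamZero ℓ k =>
      by_cases hk : ℓ.1 k = none
      · simp [milpRow, milpRhs, hk]
      · simpa [milpRow, milpRhs, base_apply, lift, baseValue, hk] using ((h0 ℓ).2.2.2.2.1.2.2 k hk).le
    | epi ℓ =>
      rw [D.epi_apply M he]
      exact sub_nonpos.2 (h0 ℓ).2.2.2.2.2.1
    | dualZero ℓ n =>
      rw [D.dualZero_apply M he]
      exact sub_nonpos.2 ((h0 ℓ).2.2.2.2.2.2 n)
    | cert ℓ =>
      rw [D.cert_apply M he]
      exact neg_le_neg (h1 ℓ).2.2.2.1
    | dualPos ℓ n =>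
      rw [D.dualPos_apply M he]
      exact sub_nonpos.2 ((h1 ℓ).2.2.2.2 n)
    | prodNonneg p =>
      obtain ⟨c0, c1⟩ := hcont p
      simp only [milpRow, milpRhs, prd_apply, LinearMap.neg_apply, lift]
      rcases hbin p with hb | hb <;> rw [hb] <;> linarith
    | prodLeBin p =>
      obtain ⟨c0, c1⟩ := hcont p
      simp only [milpRow, milpRhs, base_apply, prd_apply, LinearMap.sub_apply,
        LinearMap.smul_apply, smul_eq_mul, lift]
      rcases hbin p with hb | hb <;> rw [hb] <;> linarith
    | prodLeCont p =>
      obtain ⟨c0, c1⟩ := hcont p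
      simp only [milpRow, milpRhs, base_apply, prd_apply, LinearMap.sub_apply, lift]
      rcases hbin p with hb | hb <;> rw [hb] <;> linarith
    | prodGe p =>
      obtain ⟨c0, c1⟩ := hcont p
      simp only [milpRow, milpRhs, base_apply, prd_apply, LinearMap.sub_apply, LinearMap.add_apply,
        LinearMap.smul_apply, smul_eq_mul, lift]
      rcases hbin p with hb | hb <;> rw [hb] <;> linarith
  · rintro _ (⟨n, rfl⟩ | ⟨k, n, rfl⟩)
    · change ∃ i : ℤ, x n = i
      rcases hx n with h | h
      · exact ⟨0, by simp [h]⟩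
      · exact ⟨1, by simp [h]⟩
    · change ∃ i : ℤ, y k n = i
      rcases hy k n with h | h
      · exact ⟨0, by simp [h]⟩
      · exact ⟨1, by simp [h]⟩

/-- The duals of a given feasible point may exceed `M`. They are discarded: weak duality bounds `τ`
by the worst case, which supplies bounded duals for the same `(τ, x, y)`. -/
theorem bigM_exact (hT : IsUpwardClosed D.T) (K : ℕ) : ∃ M₀ : ℝ, ∀ M : ℝ, M₀ ≤ M →
    (∀ z : Var N R K → ℝ, (D.bigM K M).Feasible z →
      D.BilinearFeasible ((D.bigM K M).obj z) (xPart z) (yPart z) (dualPart z) ∧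
      ∀ p : Product N K, z (Sum.inr p) = z (Sum.inl (p.bin R)) * z (Sum.inl (p.cont R))) ∧
    (∀ (τ : ℝ) (x : Fin N → ℝ) (y : Fin K → Fin N → ℝ) (d : Duals N R K),
      D.BilinearFeasible τ x y d → ∃ z : Var N R K → ℝ, (D.bigM K M).Feasible z ∧
        (D.bigM K M).obj z = τ ∧ xPart z = x ∧ yPart z = y) ∧
    (D.bigM K M).value = D.bilinearValue K := by
  obtain ⟨M₀, hM₀⟩ := D.exists_bounded_duals hT K
  refine ⟨M₀, fun M hM => ?_⟩
  have hlift : ∀ (τ : ℝ) (x : Fin N → ℝ) (y : Fin K → Fin N → ℝ) (d : Duals N R K),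
      D.BilinearFeasible τ x y d → ∃ z : Var N R K → ℝ, (D.bigM K M).Feasible z ∧
        (D.bigM K M).obj z = τ ∧ xPart z = x ∧ yPart z = y := by
    intro τ x y d h
    obtain ⟨d', hd', hν, hβ, hlam⟩ := hM₀ x y τ h.1 (D.le_worstCase_of_bilinearFeasible h)
    exact ⟨lift τ x y d', D.feasible_lift hd' (fun ℓ k => (hν ℓ k).trans hM)
      (fun ℓ k n => (hβ ℓ k n).trans hM) (fun ℓ k => (hlam ℓ k).trans hM), rfl, rfl, rfl⟩
  refine ⟨fun z hz => ⟨D.bilinearFeasible_of_feasible hz, D.isExact_of_feasible hz⟩, hlift,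
    le_antisymm (iSup₂_le fun z hz => D.le_bilinearValue (D.bilinearFeasible_of_feasible hz))
      (D.bilinearValue_le fun τ x y d h => ?_)⟩
  obtain ⟨z, hz, rfl, -, -⟩ := hlift τ x y d h
  exact le_iSup₂ (f := fun z (_ : (D.bigM K M).Feasible z) => ((D.bigM K M).obj z : EReal)) z hz

end Data

end FairCover

end

theorem theorem1 :
    -- exactness of the two reformulations
    (∀ (N C R K : ℕ) (D : FairCover.Data N C R), FairCover.IsUpwardClosed D.T →
      -- the bilinear program describes the hypograph of the K-adaptability objective
      (∀ (x : Fin N → ℝ) (y : Fin K → Fin N → ℝ) (τ : ℝ),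
        (∃ d : FairCover.Duals N R K, D.BilinearFeasible τ x y d) ↔
          D.FirstStage x y ∧ (τ : EReal) ≤ D.worstCase x y) ∧
      -- the optimal values agree
      D.adaptValue K = D.bilinearValue K ∧
      -- the optimal solutions agree
      (∀ (x : Fin N → ℝ) (y : Fin K → Fin N → ℝ) (τ : ℝ),
        (D.FirstStage x y ∧ D.worstCase x y = (τ : EReal) ∧ D.adaptValue K = (τ : EReal)) ↔
          ∃ d : FairCover.Duals N R K, D.BilinearFeasible τ x y d ∧
            ∀ (τ' : ℝ) (x' : Fin N → ℝ) (y' : Fin K → Fin N → ℝ) (d' : FairCover.Duals N R K),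
              D.BilinearFeasible τ' x' y' d' → τ' ≤ τ) ∧
      -- for all sufficiently large M, the Big-M program is equivalent to the bilinear program
      (∃ M₀ : ℝ, ∀ M : ℝ, M₀ ≤ M →
        (∀ z : FairCover.Var N R K → ℝ, (D.bigM K M).Feasible z →
          D.BilinearFeasible ((D.bigM K M).obj z) (FairCover.xPart z) (FairCover.yPart z)
            (FairCover.dualPart z) ∧
          ∀ p : FairCover.Product N K,
            z (Sum.inr p) = z (Sum.inl (p.bin R)) * z (Sum.inl (p.cont R))) ∧
        (∀ (τ : ℝ) (x : Fin N → ℝ) (y : Fin K → Fin N → ℝ) (d : FairCover.Duals N R K),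
          D.BilinearFeasible τ x y d →
            ∃ z : FairCover.Var N R K → ℝ, (D.bigM K M).Feasible z ∧
              (D.bigM K M).obj z = τ ∧ FairCover.xPart z = x ∧ FairCover.yPart z = y) ∧
        (D.bigM K M).value = D.bilinearValue K)) ∧
    -- the number of indices
    (∀ N K : ℕ, Nat.card (FairCover.Idx N K) = (N + 1) ^ K) ∧
    -- the size of the MILP is the number of indices up to a factor polynomial in the inputs
    (∃ p : MvPolynomial (Fin 4) ℕ, ∀ (N C R K : ℕ) (D : FairCover.Data N C R) (M : ℝ),
      (N + 1) ^ K ≤ (D.bigM K M).numCons ∧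
      (D.bigM K M).numVars + (D.bigM K M).numCons ≤
        MvPolynomial.eval ![N, C, R, K] p * (N + 1) ^ K) ∧
    -- for each fixed K the size is polynomial
    (∀ K : ℕ, ∃ q : MvPolynomial (Fin 3) ℕ, ∀ (N C R : ℕ) (D : FairCover.Data N C R) (M : ℝ),
      (D.bigM K M).numVars + (D.bigM K M).numCons ≤ MvPolynomial.eval ![N, C, R] q) := by
  refine ⟨fun N C R K D hT => ⟨D.exists_bilinearFeasible_iff hT,
    D.adaptValue_eq_bilinearValue hT K, D.isOptimal_iff hT, D.bigM_exact hT K⟩,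
    FairCover.card_idx, ?_, ?_⟩
  · refine ⟨100 * (.X 0 + 1) ^ 2 * (.X 1 + 1) * (.X 2 + 1) * (.X 3 + 1), fun N C R K D M =>
      ⟨FairCover.card_idx_le_card_ineq N C R K, ?_⟩⟩
    simpa using FairCover.card_bigM_le D K M
  · intro K
    -- For fixed `K`, both the factor `K + 1` and the exponent are constants, so `(N + 1) ^ K` is
    -- itself a polynomial in `N`.
    refine ⟨100 * (.X 0 + 1) ^ 2 * (.X 1 + 1) * (.X 2 + 1) * (.C K + 1) * (.X 0 + 1) ^ K,
      fun N C R D M => ?_⟩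
    simpa using FairCover.card_bigM_le D K M
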